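/- All polynomials are over $\mathbb{F}_2$. For a polynomial $Q$ let $\overline{Q}(x)=Q(x+1)$. For nonzero $A\in\mathbb{F}_2[x]$ let $\sigma(A)$ be the sum of all divisors of $A$ in $\mathbb{F}_2[x]$. Call a nonzero polynomial $A$ *perfect* if $\sigma(A)=A$, and call a perfect polynomial *indecomposable* if it is not the product of two coprime nonconstant perfect polynomials. Put $$\begin{aligned} &M_1=1+x+x^2,\quad M_2=1+x+x^3,\quad M_3=1+x^2+x^3,\quad M_4=1+x+x^2+x^3+x^4,\quad M_5=1+x^3+x^4,\\ &M_6=1+x^3+x^5,\quad M_7=1+x^3+x^7,\quad M_8=1+x^6+x^7,\quad M_9=\overline{M_6},\quad M_{10}=\overline{M_7},\quad M_{11}=\overline{M_8},\\ &M_{12}=x^9+x+1,\quad M_{13}=x^9+x^8+1, \end{aligned}$$ and let $S_1,\dots,S_{15}$ be the polynomials $1+x^r(x+1)^sM_1^t$ with $(r,s,t)$ equal, in this order, to $$(1,1,1),(2,2,1),(1,3,4),(3,1,1),(1,3,1),(3,1,4),(1,1,3),(3,3,1),(1,1,5),(4,1,1),(1,2,1),(2,1,2),(1,4,1),(2,1,1),(1,2,2).$$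 Put $$\begin{aligned} &T_1=x^2(x+1)M_1,\quad T_2=\overline{T_1},\quad T_3=x^4(x+1)^3M_4,\quad T_4=\overline{T_3},\quad T_5=x^4(x+1)^4M_4\overline{M_4},\\ &T_6=x^6(x+1)^3M_2\overline{M_2},\quad T_7=\overline{T_6},\quad T_8=x^4(x+1)^6M_2\overline{M_2}M_4,\quad T_9=\overline{T_8},\\ &T_{10}=x^2(x+1)(x^4+x+1)M_1^2,\quad T_{11}=\overline{T_{10}}. \end{aligned}$$ **Theorem.** Let $A=x^a(x+1)^bA_1$ with $A_1=\prod_{i=1}^{13}M_i^{c_i}\prod_{j=1}^{15}S_j^{d_j}$, where $a,b,c_i,d_j$ are non-negative integers, $a,b\ge 1$ and $A_1\ne 1$. Then the following are equivalent: (i) $A$ is perfect; (ii) $A$ is indecomposable perfect; (iii) both $A$ and $\overline{A}$ lie in $\{T_1,\dots,T_{11}\}$; (iv) $A$ or $\overline{A}$ lies in $\{T_1,\dots,T_{11}\}$. Moreover, each of $T_1,\dots,T_{11}$ is of the form $x^a(x+1)^bA_1$ just described. -/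

import Mathlib

open Polynomial

noncomputable section

namespace BinaryPerfect

/-- A nonzero polynomial over `𝔽₂` has finitely many divisors. -/
theorem finite_setOf_dvd {A : (ZMod 2)[X]} (hA : A ≠ 0) : {D : (ZMod 2)[X] | D ∣ A}.Finite := by
  have : Finite ((ZMod 2)[X])ˣ := by
    refine Finite.of_surjective (fun _ : Unit => (1 : ((ZMod 2)[X])ˣ)) fun u => ⟨(), ?_⟩
    obtain ⟨r, hr, h⟩ := Polynomial.isUnit_iff.1 u.isUnit
    have h1 : ∀ r : ZMod 2, IsUnit r → r = 1 := by decide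
    apply Units.ext
    rw [← h, h1 r hr]
    simp
  have := Fintype.ofFinite ((ZMod 2)[X])ˣ
  have := UniqueFactorizationMonoid.fintypeSubtypeDvd A hA
  exact Set.finite_coe_iff.1 (Finite.of_fintype {x : (ZMod 2)[X] // x ∣ A})

/-- The sum `σ(A)` of all divisors of `A` (a finite sum for `A ≠ 0`). The only unit of `𝔽₂[x]`
is `1`, so there is no choice of associates to make. -/
def sigma (A : (ZMod 2)[X]) : (ZMod 2)[X] := ∑ᶠ D ∈ {D : (ZMod 2)[X] | D ∣ A}, D

/-- A nonzero polynomial over `𝔽₂` is perfect if it equals the sum of its divisors. -/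
def IsPerfect (A : (ZMod 2)[X]) : Prop := A ≠ 0 ∧ sigma A = A

/-- A perfect polynomial is indecomposable if it is not the product of two coprime nonconstant
perfect polynomials. -/
def IsIndecomposablePerfect (A : (ZMod 2)[X]) : Prop :=
  IsPerfect A ∧ ¬ ∃ B C : (ZMod 2)[X], A = B * C ∧ IsCoprime B C ∧
    0 < B.natDegree ∧ 0 < C.natDegree ∧ IsPerfect B ∧ IsPerfect C

/-- The translate of `A`, obtained by substituting `x + 1` for `x`. -/
def bar (A : (ZMod 2)[X]) : (ZMod 2)[X] := A.comp (X + 1)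

def M₁ : (ZMod 2)[X] := 1 + X + X ^ 2
def M₂ : (ZMod 2)[X] := 1 + X + X ^ 3
def M₃ : (ZMod 2)[X] := 1 + X ^ 2 + X ^ 3
def M₄ : (ZMod 2)[X] := 1 + X + X ^ 2 + X ^ 3 + X ^ 4
def M₅ : (ZMod 2)[X] := 1 + X ^ 3 + X ^ 4
def M₆ : (ZMod 2)[X] := 1 + X ^ 3 + X ^ 5
def M₇ : (ZMod 2)[X] := 1 + X ^ 3 + X ^ 7
def M₈ : (ZMod 2)[X] := 1 + X ^ 6 + X ^ 7
def M₉ : (ZMod 2)[X] := bar M₆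
def M₁₀ : (ZMod 2)[X] := bar M₇
def M₁₁ : (ZMod 2)[X] := bar M₈
def M₁₂ : (ZMod 2)[X] := X ^ 9 + X + 1
def M₁₃ : (ZMod 2)[X] := X ^ 9 + X ^ 8 + 1

/-- The Mersenne primes `M₁, …, M₁₃` (the index `i : Fin 13` stands for `i + 1`). -/
def M : Fin 13 → (ZMod 2)[X] :=
  ![M₁, M₂, M₃, M₄, M₅, M₆, M₇, M₈, M₉, M₁₀, M₁₁, M₁₂, M₁₃]

/-- `Q^{abc} = 1 + x^a (x+1)^b Q^c`. -/
def tripow (Q : (ZMod 2)[X]) (a b c : ℕ) : (ZMod 2)[X] := 1 + X ^ a * (X + 1) ^ b * Q ^ c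

/-- The 2-Mersenne primes `S₁, …, S₁₅` (the index `j : Fin 15` stands for `j + 1`). -/
def S : Fin 15 → (ZMod 2)[X] :=
  ![tripow M₁ 1 1 1, tripow M₁ 2 2 1, tripow M₁ 1 3 4, tripow M₁ 3 1 1, tripow M₁ 1 3 1,
    tripow M₁ 3 1 4, tripow M₁ 1 1 3, tripow M₁ 3 3 1, tripow M₁ 1 1 5, tripow M₁ 4 1 1,
    tripow M₁ 1 2 1, tripow M₁ 2 1 2, tripow M₁ 1 4 1, tripow M₁ 2 1 1, tripow M₁ 1 2 2]

def T₁ : (ZMod 2)[X] := X ^ 2 * (X + 1) * M₁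
def T₃ : (ZMod 2)[X] := X ^ 4 * (X + 1) ^ 3 * M₄
def T₅ : (ZMod 2)[X] := X ^ 4 * (X + 1) ^ 4 * M₄ * bar M₄
def T₆ : (ZMod 2)[X] := X ^ 6 * (X + 1) ^ 3 * M₂ * bar M₂
def T₈ : (ZMod 2)[X] := X ^ 4 * (X + 1) ^ 6 * M₂ * bar M₂ * M₄
def T₁₀ : (ZMod 2)[X] := X ^ 2 * (X + 1) * (X ^ 4 + X + 1) * M₁ ^ 2

/-- The set `{T₁, …, T₁₁}` of the known perfect polynomials. -/
def knownPerfect : Set (ZMod 2)[X] :=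
  {T₁, bar T₁, T₃, bar T₃, T₅, T₆, bar T₆, T₈, bar T₈, T₁₀, bar T₁₀}

/-- The odd part `A₁ = ∏ M_i^{c_i} ∏ S_j^{d_j}`. -/
def oddPart (c : Fin 13 → ℕ) (d : Fin 15 → ℕ) : (ZMod 2)[X] :=
  (∏ i, M i ^ c i) * ∏ j, S j ^ d j

end BinaryPerfect

end

open BinaryPerfect

/-! Call the thirty irreducibles x, x + 1, M_i, S_j the allowed primes. By unique factorization
`sigma` is multiplicative on products of their powers (`sigma_prod_pow`). Write an exponent as e =
2^k u - 1 with u odd. Frobenius then gives σ(P^e) = (1 + P + ⋯ + P^(u-1))^(2^k) (1 + P)^(2^k - 1),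
which is `geom_sum_two_pow_mul`. For every allowed P, the factor 1 + P involves only x, x + 1 and
M₁.

If A is perfect, each sum 1 + P + ⋯ + P^(u-1) divides A, so it too is a product of allowed primes.
Only few u permit this. Since (P^u - 1)' = P^(u-1) P' and P is prime to P^u - 1, repeated factors of
the sum must be paid for by P'. Hence the sum divides P' times the product of the allowed primes
(`geom_sum_dvd_prod_mul_derivative`). This bounds its degree, and a finite scan lists the possible u
(`mem_oddLengths`).

Comparing exponents in σ(A) = A turns perfection into the equations of `ExponentSystem`, whose
unknowns are the u's and the powers K = 2^k. Fifteen primes drop out at once. If u = 1 for both x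
and x + 1, then A = x^n (x+1)^n, which A₁ ≠ 1 excludes. Otherwise, equations between sums of few
powers of 2 bound all the K's, and an exhaustive search (`searchExponents`) leaves the eleven known
polynomials. Their perfection is a direct computation.

Every nonconstant perfect product of allowed primes is divisible by x, so no two such products are
coprime, and indecomposability is automatic. The known set is stable under `bar`, which links the
last two conditions to the first. -/

namespace BinaryPerfect

/-! ### Polynomials over `𝔽₂` encoded by the binary digits of natural numbers -/

/-- The polynomial whose coefficients are the binary digits of `n`. -/
noncomputable def ofBits (n : ℕ) : (ZMod 2)[X] :=
  ∑ i ∈ Finset.range (n.log2 + 1), if n.testBit i then X ^ i else 0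

theorem testBit_eq_false_of_log2_lt {n j : ℕ} (h : n.log2 < j) : n.testBit j = false :=
  Nat.testBit_lt_two_pow
    (lt_of_lt_of_le Nat.lt_log2_self (Nat.pow_le_pow_right (by norm_num) h))

theorem coeff_ofBits (n j : ℕ) : (ofBits n).coeff j = if n.testBit j then 1 else 0 := by
  have : ∀ i, (if n.testBit i then (X : (ZMod 2)[X]) ^ i else 0).coeff j =
      if j = i then (if n.testBit j then 1 else 0) else 0 := by
    intro i
    by_cases h : n.testBit i <;> by_cases hj : j = i <;> simp_all [coeff_X_pow]
  simp only [ofBits, finsetSum_coeff, this]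
  rw [Finset.sum_ite_eq]
  split_ifs with h1 h2 <;> simp_all
  have := testBit_eq_false_of_log2_lt (n := n) (j := j) (by omega)
  simp_all

theorem ofBits_xor (a b : ℕ) : ofBits (a ^^^ b) = ofBits a + ofBits b := by
  ext j
  simp only [coeff_ofBits, coeff_add, Nat.testBit_xor]
  cases a.testBit j <;> cases b.testBit j <;> simp
  decide

theorem ofBits_shiftLeft (a i : ℕ) : ofBits (a <<< i) = ofBits a * X ^ i := by
  ext j
  simp only [coeff_ofBits, coeff_mul_X_pow', Nat.testBit_shiftLeft]
  by_cases h : i ≤ j <;> simp [h]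

@[simp] theorem ofBits_zero : ofBits 0 = 0 := by ext j; simp [coeff_ofBits]

@[simp] theorem ofBits_one : ofBits 1 = 1 := by
  ext j; simp only [coeff_ofBits, coeff_one, Nat.testBit_one_eq_true_iff_self_eq_zero]

theorem ofBits_two : ofBits 2 = X := by
  simpa using ofBits_shiftLeft 1 1

theorem ofBits_three : ofBits 3 = X + 1 := by
  simpa [ofBits_two] using ofBits_xor 2 1

theorem ofBits_injective : Function.Injective ofBits := by
  intro a b h
  refine Nat.eq_of_testBit_eq fun j => ?_
  have := congrArg (fun p => p.coeff j) h
  simp only [coeff_ofBits] at this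
  revert this
  cases a.testBit j <;> cases b.testBit j <;> simp

theorem ofBits_eq_zero {a : ℕ} : ofBits a = 0 ↔ a = 0 := by
  rw [← ofBits_zero, ofBits_injective.eq_iff]

/-- Surjectivity with a size bound, so that a quantifier over polynomials of bounded degree becomes
one over a finite range of naturals. -/
theorem exists_ofBits_eq (n : ℕ) (p : (ZMod 2)[X]) (hp : ∀ i, n ≤ i → p.coeff i = 0) :
    ∃ m < 2 ^ n, ofBits m = p := by
  induction n generalizing p with
  | zero => exact ⟨0, by simp, by ext i; simp [hp i]⟩
  | succ n ih =>
    obtain ⟨m, hm, h⟩ := ih (p - C (p.coeff n) * X ^ n) (by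
      intro i hi
      rcases eq_or_lt_of_le hi with rfl | hi
      · simp
      · simp [hp i hi, hi.ne', coeff_X_pow])
    have hz : ∀ z : ZMod 2, z = 0 ∨ z = 1 := by decide
    rcases hz (p.coeff n) with h0 | h0
    · exact ⟨m, by rw [pow_succ]; omega, by simpa [h0] using h⟩
    · refine ⟨m ^^^ (1 <<< n), Nat.xor_lt_two_pow ?_ ?_, ?_⟩
      · rw [pow_succ]; omega
      · rw [Nat.one_shiftLeft, pow_succ]; have := Nat.two_pow_pos n; omega
      · rw [ofBits_xor, ofBits_shiftLeft, h, h0]; simp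

theorem natDegree_ofBits {n : ℕ} (hn : n ≠ 0) : (ofBits n).natDegree = n.log2 := by
  apply le_antisymm
  · rw [natDegree_le_iff_coeff_eq_zero]
    intro j hj
    simp [coeff_ofBits, testBit_eq_false_of_log2_lt hj]
  · apply le_natDegree_of_ne_zero
    have : n.testBit n.log2 = true := by
      simpa using Nat.testBit_log2 hn
    simp [coeff_ofBits, this]

theorem monic_of_ne_zero {p : (ZMod 2)[X]} (hp : p ≠ 0) : p.Monic := by
  have hz : ∀ z : ZMod 2, z ≠ 0 → z = 1 := by decide
  exact hz _ (leadingCoeff_ne_zero.2 hp)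

/-- Partial carry-less product, using the lowest `n` digits of `b`. -/
def mulBitsAux (a b : ℕ) : ℕ → ℕ
  | 0 => 0
  | n + 1 => Nat.xor (mulBitsAux a b n)
      (Nat.shiftLeft (Nat.mul a (Nat.land (Nat.shiftRight b n) 1)) n)

/-- Carry-less product. -/
def mulBits (a b : ℕ) : ℕ := mulBitsAux a b (Nat.succ (Nat.log2 b))

theorem ofBits_mulBits (a b : ℕ) : ofBits (mulBits a b) = ofBits a * ofBits b := by
  have : ∀ n, ofBits (mulBitsAux a b n) =
      ofBits a * ∑ i ∈ Finset.range n, if b.testBit i then X ^ i else 0 := by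
    intro n
    induction n with
    | zero => simp [mulBitsAux]
    | succ n ih =>
      have hb : Nat.land (Nat.shiftRight b n) 1 = if b.testBit n then 1 else 0 := by
        change (b >>> n) &&& 1 = _
        rw [Nat.and_one_is_mod, Nat.testBit_eq_decide_div_mod_eq, Nat.shiftRight_eq_div_pow]
        rcases Nat.mod_two_eq_zero_or_one (b / 2 ^ n) with h | h <;> simp [h]
      change ofBits (mulBitsAux a b n ^^^
        (a * Nat.land (Nat.shiftRight b n) 1) <<< n) = _
      rw [hb, ofBits_xor, ih, Finset.sum_range_succ, mul_add, ofBits_shiftLeft]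
      split_ifs <;> simp
  exact this _

/-- Carry-less power. -/
def powBits (a : ℕ) : ℕ → ℕ
  | 0 => 1
  | n + 1 => mulBits (powBits a n) a

theorem ofBits_powBits (a n : ℕ) : ofBits (powBits a n) = ofBits a ^ n := by
  induction n with
  | zero => simp [powBits]
  | succ n ih => rw [powBits, ofBits_mulBits, ih, pow_succ]

/-- The encoding of `1 + p + ⋯ + p ^ (u - 1)`. -/
def geomBits (p : ℕ) : ℕ → ℕ
  | 0 => 0
  | n + 1 => Nat.xor (mulBits (geomBits p n) p) 1

theorem ofBits_geomBits (p u : ℕ) :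
    ofBits (geomBits p u) = ∑ j ∈ Finset.range u, ofBits p ^ j := by
  induction u with
  | zero => simp [geomBits]
  | succ u ih =>
    change ofBits (mulBits (geomBits p u) p ^^^ 1) = _
    rw [ofBits_xor, ofBits_mulBits, ih, geom_sum_succ, mul_comm, ofBits_one]

/-- The encoding of `∏ i < n, p i`. -/
def prodBits (p : ℕ → ℕ) : ℕ → ℕ
  | 0 => 1
  | n + 1 => mulBits (prodBits p n) (p n)

theorem ofBits_prodBits (p : ℕ → ℕ) (n : ℕ) :
    ofBits (prodBits p n) = ∏ i ∈ Finset.range n, ofBits (p i) := by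
  induction n with
  | zero => simp [prodBits]
  | succ n ih => rw [prodBits, ofBits_mulBits, ih, Finset.prod_range_succ]

/-- Long division of `a`, of degree less than `d + n`, by `q`, of degree `d`. -/
def redBits (q d : ℕ) : ℕ → ℕ → ℕ
  | 0, a => a
  | n + 1, a => redBits q d n (Nat.xor a
      (Nat.shiftLeft (Nat.mul q (Nat.land (Nat.shiftRight a (Nat.add n d)) 1)) n))

theorem land_one_eq_zero_or_one (a : ℕ) : Nat.land a 1 = 0 ∨ Nat.land a 1 = 1 := by
  change a &&& 1 = 0 ∨ a &&& 1 = 1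
  rw [Nat.and_one_is_mod]
  exact Nat.mod_two_eq_zero_or_one a

theorem dvd_redBits (q d n a : ℕ) (h : ofBits q ∣ ofBits a) :
    ofBits q ∣ ofBits (redBits q d n a) := by
  induction n generalizing a with
  | zero => exact h
  | succ n ih =>
    apply ih
    change _ ∣ ofBits (a ^^^ (q * Nat.land (Nat.shiftRight a (Nat.add n d)) 1) <<< n)
    rw [ofBits_xor, ofBits_shiftLeft]
    rcases land_one_eq_zero_or_one (Nat.shiftRight a (Nat.add n d)) with h1 | h1 <;> rw [h1]
    · simpa using h
    · simpa using dvd_add h (dvd_mul_right _ _)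

/-- A computation showing that `q`, of degree `d`, does not divide `a`. -/
def notDvdBits (q d n a : ℕ) : Bool :=
  (fun r => !Nat.beq r 0 && Nat.blt r (2 ^ d) && Nat.ble (2 ^ d) q) (redBits q d n a)

/-- The reduction only adds multiples of `q`, so a nonzero result of degree below that of `q`
refutes divisibility. The test itself checks these sizes, so nothing need be assumed about `d` or
`n`. -/
theorem not_dvd_of_notDvdBits {q d n a : ℕ} (h : notDvdBits q d n a = true) :
    ¬ ofBits q ∣ ofBits a := by
  simp only [notDvdBits, Bool.and_eq_true, Bool.not_eq_true', Nat.blt_eq, Nat.ble_eq] at h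
  obtain ⟨⟨h0, hr⟩, hq⟩ := h
  replace h0 := Nat.ne_of_beq_eq_false h0
  intro hd
  have h2 := natDegree_le_of_dvd (dvd_redBits q d n a hd) (mt ofBits_eq_zero.1 h0)
  have hq0 : q ≠ 0 := by have := Nat.two_pow_pos d; omega
  rw [natDegree_ofBits h0, natDegree_ofBits hq0] at h2
  have h3 := (Nat.log2_lt h0).2 hr
  have h4 := (Nat.le_log2 hq0).2 hq
  omega

/-- Trial division by all polynomials of at most half the degree, for degrees below `13`. -/
def irreducibleBits (p : ℕ) : Bool :=
  (List.range (2 ^ (p.log2 / 2 + 1))).all fun d => Nat.ble d 1 || notDvdBits d d.log2 13 p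

theorem irreducible_of_irreducibleBits {p : ℕ} (h1 : 1 < p) (h : irreducibleBits p = true) :
    Irreducible (ofBits p) := by
  have h0 : p ≠ 0 := by omega
  rw [(monic_of_ne_zero (mt ofBits_eq_zero.1 h0)).irreducible_iff_lt_natDegree_lt
    (by rw [← ofBits_one, ofBits_injective.ne_iff]; omega)]
  intro q _ hd
  rw [Finset.mem_Ioc, natDegree_ofBits h0] at hd
  obtain ⟨m, hm, rfl⟩ := exists_ofBits_eq (p.log2 / 2 + 1) q
    (fun i hi => coeff_eq_zero_of_natDegree_lt (by omega))
  simp only [irreducibleBits, List.all_eq_true, List.mem_range, Bool.or_eq_true,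
    Nat.ble_eq] at h
  rcases h m hm with h | h
  · interval_cases m <;> simp at hd
  · exact not_dvd_of_notDvdBits h

/-- The derivative of polynomials of degree at most `14`. -/
def derivBits (n : ℕ) : ℕ := (n >>> 1) &&& 5461

/-- Over 𝔽₂ only odd powers survive differentiation, and they land in even degrees. The mask 5461
has its ones at the even positions 0, 2, …, 12. -/
theorem derivative_ofBits {n : ℕ} (hn : n < 2 ^ 14) :
    derivative (ofBits n) = ofBits (derivBits n) := by
  ext j
  simp only [coeff_derivative, coeff_ofBits, derivBits, Nat.testBit_and, Nat.testBit_shiftRight]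
  rcases lt_or_ge j 13 with hj | hj
  · rw [add_comm 1 j]
    cases n.testBit (j + 1)
    · simp
    · interval_cases j <;> simp <;> decide
  · have : n.testBit (j + 1) = false :=
      Nat.testBit_lt_two_pow (lt_of_lt_of_le hn (Nat.pow_le_pow_right (by norm_num) (by omega)))
    simp [add_comm 1 j, this]

/-! ### Products of powers of distinct irreducible polynomials -/

theorem eq_one_of_isUnit {p : (ZMod 2)[X]} (h : IsUnit p) : p = 1 :=
  (monic_of_ne_zero h.ne_zero).eq_one_of_isUnit h

theorem eq_of_associated {p q : (ZMod 2)[X]} (h : Associated p q) : p = q := by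
  obtain ⟨u, rfl⟩ := h
  rw [eq_one_of_isUnit u.isUnit, mul_one]

theorem isCoprime_of_ne {ι : Type*} {L : ι → (ZMod 2)[X]} (hL : ∀ i, Irreducible (L i))
    (hinj : Function.Injective L) {i j : ι}
    (h : i ≠ j) : IsCoprime (L i) (L j) :=
  (hL i).coprime_iff_not_dvd.2 fun hd =>
    h (hinj (eq_of_associated ((hL i).associated_of_dvd (hL j) hd)))

section Family

variable {ι : Type*} [Fintype ι] {L : ι → (ZMod 2)[X]}

theorem prod_pow_ne_zero (hL : ∀ i, Irreducible (L i)) (e : ι → ℕ) : ∏ i, L i ^ e i ≠ 0 :=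
  Finset.prod_ne_zero_iff.2 fun i _ => pow_ne_zero _ (hL i).ne_zero

theorem exists_eq_prod_pow_of_dvd (hL : ∀ i, Irreducible (L i)) {e : ι → ℕ} {D : (ZMod 2)[X]}
    (hD : D ∣ ∏ i, L i ^ e i) : ∃ f : ι → ℕ, (∀ i, f i ≤ e i) ∧ D = ∏ i, L i ^ f i := by
  classical
  suffices H : ∀ (s : Finset ι) (D : (ZMod 2)[X]), D ∣ ∏ i ∈ s, L i ^ e i →
      ∃ f : ι → ℕ, (∀ i, f i ≤ e i) ∧ D = ∏ i ∈ s, L i ^ f i from H _ D hD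
  intro s
  induction s using Finset.induction_on with
  | empty =>
    intro D h
    exact ⟨0, fun i => Nat.zero_le _, by
      simpa using eq_one_of_isUnit (isUnit_of_dvd_one (by simpa using h))⟩
  | insert j s hj ih =>
    intro D h
    rw [Finset.prod_insert hj] at h
    obtain ⟨B, C, hB, hC, rfl⟩ := exists_dvd_and_dvd_of_dvd_mul h
    obtain ⟨f, hf, rfl⟩ := ih C hC
    obtain ⟨m, hm, hBm⟩ := (dvd_prime_pow (hL j).prime _).1 hB
    refine ⟨Function.update f j m, fun i => ?_, ?_⟩
    · by_cases h : i = j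
      · subst h; simpa using hm
      · simpa [h] using hf i
    · rw [Finset.prod_insert hj, eq_of_associated hBm, Function.update_self]
      congr 1
      refine Finset.prod_congr rfl fun i hi => ?_
      rw [Function.update_of_ne (ne_of_mem_of_not_mem hi hj)]

theorem le_of_prod_pow_dvd (hL : ∀ i, Irreducible (L i)) (hinj : Function.Injective L)
    {e f : ι → ℕ} (h : ∏ i, L i ^ e i ∣ ∏ i, L i ^ f i) (q : ι) : e q ≤ f q := by
  classical
  have h1 : L q ^ e q ∣ L q ^ f q * ∏ i ∈ Finset.univ.erase q, L i ^ f i := by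
    rw [Finset.mul_prod_erase _ (fun i => L i ^ f i) (Finset.mem_univ q)]
    exact (Finset.dvd_prod_of_mem (fun i => L i ^ e i) (Finset.mem_univ q)).trans h
  have h2 : IsCoprime (L q ^ e q) (∏ i ∈ Finset.univ.erase q, L i ^ f i) :=
    IsCoprime.prod_right fun i hi =>
      (isCoprime_of_ne hL hinj (Finset.ne_of_mem_erase hi).symm).pow
  exact (pow_dvd_pow_iff (hL q).ne_zero (hL q).not_isUnit).1 (h2.dvd_of_dvd_mul_right h1)

theorem prod_pow_injective (hL : ∀ i, Irreducible (L i)) (hinj : Function.Injective L) :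
    Function.Injective fun e : ι → ℕ => ∏ i, L i ^ e i := fun _ _ h =>
  funext fun q => le_antisymm (le_of_prod_pow_dvd hL hinj (Eq.dvd h) q)
    (le_of_prod_pow_dvd hL hinj (Eq.dvd (Eq.symm h)) q)

/-- The divisors correspond bijectively to exponent vectors bounded by `e`, and the sum over this
box factors. -/
theorem sigma_prod_pow (hL : ∀ i, Irreducible (L i)) (hinj : Function.Injective L) (e : ι → ℕ) :
    sigma (∏ i, L i ^ e i) = ∏ i, ∑ j ∈ Finset.range (e i + 1), L i ^ j := by
  classical
  have hset : {D : (ZMod 2)[X] | D ∣ ∏ i, L i ^ e i} =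
      ((Fintype.piFinset fun i => Finset.range (e i + 1)).image
        fun f => ∏ i, L i ^ f i : Finset (ZMod 2)[X]) := by
    ext D
    simp only [Set.mem_ofPred_eq, Finset.coe_image, Set.mem_image, Finset.mem_coe,
      Fintype.mem_piFinset, Finset.mem_range, Nat.lt_succ_iff]
    constructor
    · intro h
      obtain ⟨f, hf, rfl⟩ := exists_eq_prod_pow_of_dvd hL h
      exact ⟨f, hf, rfl⟩
    · rintro ⟨f, hf, rfl⟩
      exact Finset.prod_dvd_prod_of_dvd _ _ fun i _ => pow_dvd_pow _ (hf i)
  rw [sigma, hset, finsum_mem_coe_finset,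
    Finset.sum_image (prod_pow_injective hL hinj).injOn, Finset.prod_univ_sum]

/-- If `1 + P + ⋯ + P ^ (u - 1)`, with `u` odd, is a product of powers of the `L i`, then it
divides the product of the `L i` and the derivative of `P`. -/
theorem geom_sum_dvd_prod_mul_derivative (hL : ∀ i, Irreducible (L i))
    (hinj : Function.Injective L) {P : (ZMod 2)[X]} {u : ℕ} (hu : Odd u) {f : ι → ℕ}
    (h : ∑ j ∈ Finset.range u, P ^ j = ∏ i, L i ^ f i) :
    ∑ j ∈ Finset.range u, P ^ j ∣ (∏ i, L i) * derivative P := by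
  have hder : derivative (P ^ u - 1) = P ^ (u - 1) * derivative P := by
    have : (u : ZMod 2) = 1 := by
      obtain ⟨m, rfl⟩ := hu
      have : (2 : ZMod 2) = 0 := by decide
      push_cast; rw [this]; ring
    rw [derivative_sub, derivative_one, derivative_pow, this]
    simp
  -- Differentiating P^u - 1 lowers the multiplicity of `L i` by at most one. An `L i` dividing both
  -- P and P^u - 1 would divide 1, so the factor P^(u-1) can be removed.
  have key : ∀ i, L i ^ (f i - 1) ∣ derivative P := by
    intro i
    rcases Nat.eq_zero_or_pos (f i) with h0 | h0
    · simp [h0]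
    have hd : L i ^ f i ∣ P ^ u - 1 := by
      rw [← geom_sum_mul, h]
      exact (Finset.dvd_prod_of_mem (fun i => L i ^ f i) (Finset.mem_univ i)).mul_right _
    have h1 : L i ^ (f i - 1) ∣ P ^ (u - 1) * derivative P := by
      rw [← hder]
      exact pow_sub_one_dvd_derivative_of_pow_dvd hd
    refine IsCoprime.dvd_of_dvd_mul_left (IsCoprime.pow ?_) h1
    refine (hL i).coprime_iff_not_dvd.2 fun hP => ?_
    have h2 : L i ∣ P ^ u - 1 := (dvd_pow_self _ h0.ne').trans hd
    have h3 : L i ∣ P ^ u := hP.trans (dvd_pow_self _ hu.pos.ne')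
    exact (hL i).not_isUnit (isUnit_of_dvd_one ((dvd_sub_right h3).1 h2))
  have h1 : ∏ i, L i ^ (f i - 1) ∣ derivative P :=
    Fintype.prod_dvd_of_coprime
      (fun i j hij => (isCoprime_of_ne hL hinj hij).pow) key
  rw [h]
  refine dvd_trans ?_ (mul_dvd_mul_left _ h1)
  rw [← Finset.prod_mul_distrib]
  refine Finset.prod_dvd_prod_of_dvd _ _ fun i _ => ?_
  rw [← pow_succ']
  exact pow_dvd_pow _ (by omega)

end Family

/-- After multiplication by P - 1 this is P^(2^k u) - 1 = (P^u - 1)^(2^k). The case P = 1, where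
cancellation fails, is treated separately. -/
theorem geom_sum_two_pow_mul (P : (ZMod 2)[X]) (k u : ℕ) :
    ∑ j ∈ Finset.range (2 ^ k * u), P ^ j =
      (∑ j ∈ Finset.range u, P ^ j) ^ 2 ^ k * (1 + P) ^ (2 ^ k - 1) := by
  have : CharP (ZMod 2)[X] 2 := inferInstance
  by_cases hP : P = 1
  · subst hP
    rcases Nat.eq_zero_or_pos k with rfl | hk
    · simp
    · have h2 : (2 : (ZMod 2)[X]) = 0 := CharTwo.two_eq_zero
      have : 2 ^ k - 1 ≠ 0 := by
        have := Nat.one_lt_two_pow hk.ne'; omega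
      simp [h2, hk.ne', this, one_add_one_eq_two]
  have hne : P - 1 ≠ 0 := sub_ne_zero.2 hP
  apply mul_right_cancel₀ hne
  have e1 : (1 + P : (ZMod 2)[X]) = P - 1 := by rw [CharTwo.sub_eq_add, add_comm]
  have e2 : (P - 1) ^ (2 ^ k - 1) * (P - 1) = (P - 1) ^ 2 ^ k := by
    rw [← pow_succ, Nat.sub_add_cancel Nat.one_le_two_pow]
  rw [geom_sum_mul, e1, mul_assoc, e2, ← mul_pow, geom_sum_mul, sub_pow_char_pow, one_pow,
    ← pow_mul, mul_comm]

/-! ### The thirty irreducible polynomials -/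

/-- The encodings of `x`, `x + 1`, `M₁, …, M₁₃`, `S₁, …, S₁₅`, in this order. -/
def code (i : ℕ) : ℕ :=
  [2, 3, 7, 11, 13, 31, 25, 41, 137, 193, 61, 241, 171, 515, 769, 19, 109, 8191, 73, 91, 6553,
    379, 361, 4915, 145, 55, 253, 239, 37, 131].getD i 0

/-- The irreducible polynomials `x`, `x + 1`, `M₁, …, M₁₃`, `S₁, …, S₁₅`, in this order. -/
noncomputable def factor (i : ℕ) : (ZMod 2)[X] := ofBits (code i)

/-- The exponents of `x`, `x + 1` and `M₁` in `factor i + 1`. -/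
def succTriple (i : ℕ) : ℕ × ℕ × ℕ :=
  [(0, 1, 0), (1, 0, 0), (1, 1, 0), (1, 2, 0), (2, 1, 0), (1, 3, 0), (3, 1, 0), (3, 2, 0),
    (3, 4, 0), (6, 1, 0), (2, 3, 0), (4, 3, 0), (1, 6, 0), (1, 8, 0), (8, 1, 0), (1, 1, 1),
    (2, 2, 1), (1, 3, 4), (3, 1, 1), (1, 3, 1), (3, 1, 4), (1, 1, 3), (3, 3, 1), (1, 1, 5),
    (4, 1, 1), (1, 2, 1), (2, 1, 2), (1, 4, 1), (2, 1, 1), (1, 2, 2)].getD i (0, 0, 0)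

/-- The exponent of `factor q` in `1 + factor i`. -/
def succExp (i q : ℕ) : ℕ :=
  match q with
  | 0 => (succTriple i).1
  | 1 => (succTriple i).2.1
  | 2 => (succTriple i).2.2
  | _ => 0

/-- The odd `u` for which `1 + P + ⋯ + P ^ (u - 1)`, `P = factor i`, is a product of the listed
irreducible polynomials. -/
def oddLengths : ℕ → List ℕ
  | 0 | 1 => [1, 3, 5, 7, 9, 13, 15]
  | 2 => [1, 3, 5, 7, 15]
  | 3 | 4 | 15 | 16 => [1, 3]
  | _ => [1]

/-- Those `u ∈ oddLengths i` for which `factor q` divides `1 + P + ⋯ + P ^ (u - 1)`,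
`P = factor i`. -/
def divLengths : ℕ → ℕ → List ℕ
  | 0, 2 | 1, 2 => [3, 9, 15]
  | 0, 3 | 0, 4 | 1, 3 | 1, 4 => [7]
  | 0, 5 | 1, 6 => [5, 15]
  | 0, 6 | 1, 5 => [15]
  | 0, 15 | 1, 15 => [15]
  | 0, 17 | 1, 20 => [13]
  | 0, 18 | 1, 19 => [9]
  | 2, 3 | 2, 4 | 2, 16 => [7]
  | 2, 5 | 2, 6 | 2, 21 => [15]
  | 2, 15 => [3, 15]
  | 2, 22 => [5, 15]
  | 3, 2 | 3, 6 | 4, 2 | 4, 5 | 15, 5 | 15, 6 | 16, 15 | 16, 21 => [3]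
  | _, _ => []

/-- The exponent of `factor q` in `1 + P + ⋯ + P ^ (u - 1)`, `P = factor i`. -/
def geomExp (i u q : ℕ) : ℕ := if u ∈ divLengths i q then 1 else 0

theorem irreducible_factor {i : ℕ} (hi : i < 30) : Irreducible (factor i) := by
  have h : ∀ i < 30, 1 < code i ∧ irreducibleBits (code i) = true := by decide +kernel
  exact irreducible_of_irreducibleBits (h i hi).1 (h i hi).2

theorem factor_injective : Function.Injective fun i : Fin 30 => factor i := by
  have h : ∀ i < 30, ∀ j < 30, code i = code j → i = j := by decide +kernel
  exact fun i j hij => Fin.ext (h i i.2 j j.2 (ofBits_injective hij))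

theorem one_add_factor {i : ℕ} (hi : i < 30) :
    1 + factor i = ∏ q ∈ Finset.range 30, factor q ^ succExp i q := by
  have h : ∀ i < 30, 1 ^^^ code i = prodBits (fun q => powBits (code q) (succExp i q)) 30 := by
    decide +kernel
  simpa only [factor, ofBits_xor, ofBits_one, ofBits_prodBits, ofBits_powBits] using
    congrArg ofBits (h i hi)

theorem geom_sum_factor {i u : ℕ} (hi : i < 30) (hu : u ∈ oddLengths i) :
    ∑ j ∈ Finset.range u, factor i ^ j = ∏ q ∈ Finset.range 30, factor q ^ geomExp i u q := by
  have h : ∀ i < 30, ∀ u ∈ oddLengths i,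
      geomBits (code i) u = prodBits (fun q => powBits (code q) (geomExp i u q)) 30 := by
    decide +kernel
  simpa only [factor, ofBits_geomBits, ofBits_prodBits, ofBits_powBits] using
    congrArg ofBits (h i hi u hu)

/-- Starting from `r = geomBits p u` of degree `d`, check for the next `n` values of `u` that an
odd `u` outside `l` has `geomBits p u` not dividing `N`. -/
def scanLengths (p deg N : ℕ) (l : List ℕ) : ℕ → ℕ → ℕ → ℕ → Bool
  | 0, _, _, _ => true
  | n + 1, u, r, d =>
    (Nat.beq (u % 2) 0 || l.contains u || notDvdBits r d (Nat.sub 200 d) N) &&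
      scanLengths p deg N l n (Nat.succ u) (Nat.xor (mulBits r p) 1) (Nat.add d deg)

/-- The scan updates the sum by Horner's rule, so its accumulator remains `geomBits p u`. The
running degree `d` needs no invariant, since each non-divisibility test checks it. -/
theorem mem_of_scanLengths {p deg N : ℕ} {l : List ℕ} {n u d v : ℕ}
    (h : scanLengths p deg N l n u (geomBits p u) d = true) (hu : u ≤ v) (hv : v < u + n)
    (hodd : Odd v) (hd : ofBits (geomBits p v) ∣ ofBits N) : v ∈ l := by
  induction n generalizing u d with
  | zero => omega
  | succ n ih =>
    simp only [scanLengths, Bool.and_eq_true, Bool.or_eq_true, Nat.beq_eq,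
      List.contains_iff_mem] at h
    rcases eq_or_lt_of_le hu with rfl | hlt
    · rcases h.1 with (h | h) | h
      · rw [Nat.odd_iff] at hodd; omega
      · exact h
      · exact absurd hd (not_dvd_of_notDvdBits h)
    · exact ih h.2 hlt (by omega)

/-- The encoding of the product of the listed polynomials and the derivative of `factor i`. -/
def lengthBound (i : ℕ) : ℕ := mulBits (prodBits code 30) (derivBits (code i))

/-- The thirty degrees add up to 186 and a derivative has degree at most 11, so the constant 200 in
`scanLengths` allows complete long division. -/
theorem scanLengths_code : ∀ i < 30, 1 < code i ∧ code i < 2 ^ 14 ∧ lengthBound i ≠ 0 ∧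
    scanLengths (code i) (code i).log2 (lengthBound i) (oddLengths i)
      ((lengthBound i).log2 / (code i).log2 + 1) 1 1 0 = true := by
  decide +kernel

theorem natDegree_geom_sum {P : (ZMod 2)[X]} (hP : 0 < P.natDegree) (m : ℕ) :
    (∑ j ∈ Finset.range (m + 1), P ^ j).natDegree = m * P.natDegree := by
  induction m with
  | zero => simp
  | succ m ih =>
    rw [Finset.sum_range_succ, natDegree_add_eq_right_of_natDegree_lt, natDegree_pow]
    rw [ih, natDegree_pow]
    exact Nat.mul_lt_mul_of_pos_right (Nat.lt_succ_self m) hP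

/-- The sum has degree (u - 1) deg p, at most deg N, so every candidate u lies in the scanned range.
-/
theorem mem_oddLengths_of_dvd {p N : ℕ} {l : List ℕ} {u : ℕ} (hp : 1 < p) (hN : N ≠ 0)
    (hs : scanLengths p p.log2 N l (N.log2 / p.log2 + 1) 1 1 0 = true) (hu : Odd u)
    (hd : ofBits (geomBits p u) ∣ ofBits N) : u ∈ l := by
  have h1 : geomBits p 1 = 1 := ofBits_injective (by simp [ofBits_geomBits])
  refine mem_of_scanLengths (u := 1) (by simpa only [h1] using hs) hu.pos ?_ hu hd
  have hdeg := natDegree_le_of_dvd hd (mt ofBits_eq_zero.1 hN)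
  have hlog : 0 < p.log2 := by
    rw [Nat.lt_iff_add_one_le, Nat.le_log2 (by omega)]; omega
  have hpd : (ofBits p).natDegree = p.log2 := natDegree_ofBits (by omega)
  obtain ⟨m, rfl⟩ : ∃ m, u = m + 1 := ⟨u - 1, by have := hu.pos; omega⟩
  rw [ofBits_geomBits, natDegree_geom_sum (hpd ▸ hlog), hpd, natDegree_ofBits hN] at hdeg
  have := (Nat.le_div_iff_mul_le hlog).2 hdeg
  omega

theorem mem_oddLengths {i u : ℕ} (hi : i < 30) (hu : Odd u) {f : Fin 30 → ℕ}
    (h : ∑ j ∈ Finset.range u, factor i ^ j = ∏ q : Fin 30, factor q ^ f q) :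
    u ∈ oddLengths i := by
  obtain ⟨h1, h14, hN, hs⟩ := scanLengths_code i hi
  refine mem_oddLengths_of_dvd h1 hN hs hu ?_
  have := geom_sum_dvd_prod_mul_derivative
    (fun j : Fin 30 => irreducible_factor j.2) factor_injective hu h
  rw [← Finset.prod_range factor] at this
  rw [lengthBound, ofBits_geomBits, ofBits_mulBits, ofBits_prodBits, ← derivative_ofBits h14]
  exact this

theorem factor_eq (i : ℕ) : factor i = ofBits (code i) := rfl

attribute [irreducible] factor

/-! ### Arithmetic of the exponents -/

/-- `p.2` if `p.1` belongs to `l`, and `0` otherwise. -/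
def pick (l : List ℕ) (p : ℕ × ℕ) : ℕ := bif l.elem p.1 then p.2 else 0

/-- The pairs `(u, 2 ^ k)` that can occur for `x` and `x + 1`; the irrelevant power is replaced
by `0` if `u = 1`. -/
def linearPairs : List (ℕ × ℕ) :=
  [(1, 0), (3, 1), (3, 2), (3, 4), (3, 8), (3, 16), (3, 32), (3, 64), (3, 128), (5, 1), (5, 2),
    (5, 4), (5, 8), (5, 16), (5, 32), (7, 1), (7, 2), (7, 4), (7, 8), (9, 1), (13, 1), (15, 1),
    (15, 2), (15, 4), (15, 8)]

/-- The pairs `(u, 2 ^ k)` that can occur for `M₁`; the irrelevant power is replaced by `0` if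
`u = 1`. -/
def quadraticPairs : List (ℕ × ℕ) :=
  [(1, 0), (3, 1), (3, 2), (3, 4), (3, 8), (5, 1), (7, 1), (7, 2), (15, 1)]

/-- The pairs `(u, 2 ^ k)` that can occur for `M₂`, `M₃`, `S₁` and `S₂`. -/
def smallPairs : List (ℕ × ℕ) :=
  [(1, 1), (1, 2), (1, 4), (1, 8), (1, 16), (3, 1), (3, 2), (3, 4), (3, 8)]

/-- The exponents, increased by `1`, of `x`, `x + 1`, `M₁`, `M₂`, `M₄`, `M₅`, `S₁` in the known
perfect polynomials. -/
def solutions : List (List ℕ) :=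
  [[3, 2, 2, 1, 1, 1, 1], [2, 3, 2, 1, 1, 1, 1], [5, 4, 1, 1, 2, 1, 1], [4, 5, 1, 1, 1, 2, 1],
    [5, 5, 1, 1, 2, 2, 1], [7, 4, 1, 2, 1, 1, 1], [4, 7, 1, 2, 1, 1, 1], [5, 7, 1, 2, 2, 1, 1],
    [7, 5, 1, 2, 1, 2, 1], [3, 2, 3, 1, 1, 1, 2], [2, 3, 3, 1, 1, 1, 2]]

/-- The powers of `2` up to `1024`. -/
def powers : List ℕ := [1, 2, 4, 8, 16, 32, 64, 128, 256, 512, 1024]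

/-- If `a = b`, then `p`. -/
def whenEq (a b : ℕ) (p : Bool) : Bool := cond (Nat.beq a b) p true

theorem whenEq_eq_true {a b : ℕ} {p : Bool} : whenEq a b p = true ↔ (a = b → p = true) := by
  rw [whenEq]
  cases h : Nat.beq a b
  · simp [Nat.ne_of_beq_eq_false h]
  · simp [Nat.eq_of_beq_eq_true h]

/-- Exhaustive search for the exponents of a perfect polynomial. -/
def searchExponents : Bool :=
  quadraticPairs.all fun m => smallPairs.all fun d => whenEq (pick [7] m + 1) (d.2 * d.1) <|
  linearPairs.all fun x => linearPairs.all fun y => cond (Nat.beq (x.1 * y.1) 1) true <|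
  smallPairs.all fun b =>
    whenEq (pick [7] x + pick [7] y + pick [7] m + 1) (b.2 * b.1) <|
  smallPairs.all fun c =>
    whenEq (pick [15] x + pick [15] y + pick [3, 15] m + pick [3] d + 1) (c.2 * c.1) <|
  powers.all fun K₂ =>
    whenEq (pick [3, 9, 15] x + pick [3, 9, 15] y + 2 * pick [3] b + c.2 + d.2 +
      4 * pick [13] x + pick [9] x + pick [9] y + 4 * pick [13] y +
      3 * (pick [15] m + pick [3] d) + pick [5, 15] m) (K₂ * m.1 + 1) <|
  cond (!Nat.beq m.1 1 && !Nat.beq K₂ m.2) true <|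
  powers.all fun K₅ =>
    whenEq (pick [5, 15] x + pick [15] y + pick [15] m + pick [3] b + pick [3] c + 1) K₅ <|
  powers.all fun K₆ =>
    whenEq (pick [15] x + pick [5, 15] y + pick [15] m + pick [3] b + pick [3] c + 1) K₆ <|
  powers.all fun K₀ => cond (!Nat.beq x.1 1 && !Nat.beq K₀ x.2) true <|
  powers.all fun K₁ => cond (!Nat.beq y.1 1 && !Nat.beq K₁ y.2) true <|
    whenEq (K₁ + K₂ + 3 * b.2 + K₅ + 3 * K₆ + c.2 + 2 * d.2 + pick [13] x +
      3 * pick [9] x + pick [9] y + 3 * pick [13] y + (pick [15] m + pick [3] d) +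
      3 * pick [5, 15] m) (K₀ * x.1 + 11) <|
    whenEq (K₀ + K₂ + 3 * b.2 + 3 * K₅ + K₆ + c.2 + 2 * d.2 + 3 * pick [13] x +
      pick [9] x + 3 * pick [9] y + pick [13] y + (pick [15] m + pick [3] d) +
      3 * pick [5, 15] m) (K₁ * y.1 + 11) <|
    decide ([K₀ * x.1, K₁ * y.1, K₂ * m.1, b.2 * b.1, K₅, K₆, c.2 * c.1] ∈ solutions ∧
      d.2 * d.1 = 1 ∧ pick [13] x = 0 ∧ pick [9] x = 0 ∧ pick [9] y = 0 ∧ pick [13] y = 0 ∧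
      pick [15] m + pick [3] d = 0 ∧ pick [5, 15] m = 0)

theorem searchExponents_eq_true : searchExponents = true := by
  decide +kernel

theorem search {x y m b c d : ℕ × ℕ} {K₀ K₁ K₂ K₅ K₆ : ℕ} (hx : x ∈ linearPairs)
    (hy : y ∈ linearPairs) (hm : m ∈ quadraticPairs) (hb : b ∈ smallPairs) (hc : c ∈ smallPairs)
    (hd : d ∈ smallPairs) (h₀ : K₀ ∈ powers) (h₁ : K₁ ∈ powers) (h₂ : K₂ ∈ powers)
    (h₅ : K₅ ∈ powers) (h₆ : K₆ ∈ powers) (hxy : x.1 * y.1 ≠ 1) (hx0 : x.1 = 1 ∨ K₀ = x.2)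
    (hy0 : y.1 = 1 ∨ K₁ = y.2) (hm0 : m.1 = 1 ∨ K₂ = m.2)
    (eb : pick [7] x + pick [7] y + pick [7] m + 1 = b.2 * b.1)
    (ed : pick [7] m + 1 = d.2 * d.1)
    (ec : pick [15] x + pick [15] y + pick [3, 15] m + pick [3] d + 1 = c.2 * c.1)
    (em : pick [3, 9, 15] x + pick [3, 9, 15] y + 2 * pick [3] b + c.2 + d.2 +
      4 * pick [13] x + pick [9] x + pick [9] y + 4 * pick [13] y +
      3 * (pick [15] m + pick [3] d) + pick [5, 15] m = K₂ * m.1 + 1)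
    (e₅ : pick [5, 15] x + pick [15] y + pick [15] m + pick [3] b + pick [3] c + 1 = K₅)
    (e₆ : pick [15] x + pick [5, 15] y + pick [15] m + pick [3] b + pick [3] c + 1 = K₆)
    (ex : K₁ + K₂ + 3 * b.2 + K₅ + 3 * K₆ + c.2 + 2 * d.2 + pick [13] x + 3 * pick [9] x +
      pick [9] y + 3 * pick [13] y + (pick [15] m + pick [3] d) + 3 * pick [5, 15] m =
        K₀ * x.1 + 11)
    (ey : K₀ + K₂ + 3 * b.2 + 3 * K₅ + K₆ + c.2 + 2 * d.2 + 3 * pick [13] x + pick [9] x +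
      3 * pick [9] y + pick [13] y + (pick [15] m + pick [3] d) + 3 * pick [5, 15] m =
        K₁ * y.1 + 11) :
    [K₀ * x.1, K₁ * y.1, K₂ * m.1, b.2 * b.1, K₅, K₆, c.2 * c.1] ∈ solutions ∧
      d.2 * d.1 = 1 ∧ pick [13] x = 0 ∧ pick [9] x = 0 ∧ pick [9] y = 0 ∧ pick [13] y = 0 ∧
      pick [15] m + pick [3] d = 0 ∧ pick [5, 15] m = 0 := by
  have side : ∀ {p : ℕ × ℕ} {K : ℕ}, p.1 = 1 ∨ K = p.2 →
      (!Nat.beq p.1 1 && !Nat.beq K p.2) = false := by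
    rintro p K (h | h) <;> simp [h]
  have hne : Nat.beq (x.1 * y.1) 1 = false := by
    cases h : Nat.beq (x.1 * y.1) 1
    · rfl
    · exact absurd (Nat.eq_of_beq_eq_true h) hxy
  have S := List.all_eq_true.1 searchExponents_eq_true m hm
  replace S := whenEq_eq_true.1 (List.all_eq_true.1 S d hd) ed
  replace S := List.all_eq_true.1 (List.all_eq_true.1 S x hx) y hy
  rw [hne, cond_false] at S
  replace S := whenEq_eq_true.1 (List.all_eq_true.1 S b hb) eb
  replace S := whenEq_eq_true.1 (List.all_eq_true.1 S c hc) ec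
  replace S := whenEq_eq_true.1 (List.all_eq_true.1 S K₂ h₂) em
  rw [side hm0, cond_false] at S
  replace S := whenEq_eq_true.1 (List.all_eq_true.1 S K₅ h₅) e₅
  replace S := whenEq_eq_true.1 (List.all_eq_true.1 S K₆ h₆) e₆
  replace S := List.all_eq_true.1 S K₀ h₀
  rw [side hx0, cond_false] at S
  replace S := List.all_eq_true.1 S K₁ h₁
  rw [side hy0, cond_false] at S
  exact of_decide_eq_true (whenEq_eq_true.1 (whenEq_eq_true.1 S ex) ey)

/-! ### Equations between sums of powers of two -/

/-- `n` is a power of `2`. -/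
def IsPowTwo (n : ℕ) : Prop := ∃ k, n = 2 ^ k

theorem IsPowTwo.pos {n : ℕ} (h : IsPowTwo n) : 0 < n := by
  obtain ⟨k, rfl⟩ := h; exact Nat.two_pow_pos k

theorem IsPowTwo.dvd_of_le {m n : ℕ} (hm : IsPowTwo m) (hn : IsPowTwo n) (h : m ≤ n) : m ∣ n := by
  obtain ⟨k, rfl⟩ := hm
  obtain ⟨l, rfl⟩ := hn
  exact pow_dvd_pow 2 ((Nat.pow_le_pow_iff_right (by norm_num)).1 h)

theorem IsPowTwo.cases {n : ℕ} (h : IsPowTwo n) :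
    n = 1 ∨ n = 2 ∨ n = 4 ∨ n = 8 ∨ ∃ m, 0 < m ∧ n = 16 * m := by
  obtain ⟨k, rfl⟩ := h
  rcases lt_or_ge k 4 with hk | hk
  · interval_cases k <;> simp
  · obtain ⟨j, rfl⟩ := Nat.exists_eq_add_of_le hk
    exact Or.inr (Or.inr (Or.inr (Or.inr ⟨2 ^ j, by positivity, by rw [pow_add]; norm_num⟩)))

theorem IsPowTwo.mem_powers {n : ℕ} (h : IsPowTwo n) (hn : n < 2048) : n ∈ powers := by
  obtain ⟨k, rfl⟩ := h
  have hk : k < 11 := (Nat.pow_lt_pow_iff_right (a := 2) (by norm_num)).1 (by simpa using hn)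
  interval_cases k <;> simp [powers]

/-- Suppose a ≥ 16. If 16 divides K, then b + c ≡ 15 modulo 16, impossible for two terms that are 0,
1, 2, 4 or 8 modulo 16. If K ≤ 8, then K = 8, u = 3, a = 16 and b + c = 7, impossible too. -/
theorem le_eight_of_sum {a b c K u : ℕ} (ha : a = 0 ∨ IsPowTwo a) (hb : b = 0 ∨ IsPowTwo b)
    (hc : c = 0 ∨ IsPowTwo c) (hK : IsPowTwo K) (hu : u ∈ [1, 3])
    (h : a + b + c + 1 = K * u) : a ≤ 8 := by
  have H : ∀ {n : ℕ}, (n = 0 ∨ IsPowTwo n) →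
      n = 0 ∨ n = 1 ∨ n = 2 ∨ n = 4 ∨ n = 8 ∨ ∃ m, 0 < m ∧ n = 16 * m :=
    fun h => h.imp_right IsPowTwo.cases
  have key : a + b + c + 1 = K ∨ a + b + c + 1 = 3 * K := by
    have hu' : u = 1 ∨ u = 3 := by simpa using hu
    rcases hu' with rfl | rfl <;> omega
  rcases H ha with ha | ha | ha | ha | ha | ⟨x, hx, rfl⟩ <;> try omega
  rcases hK.cases with rfl | rfl | rfl | rfl | ⟨k, hk, rfl⟩ <;>
  rcases H hb with rfl | rfl | rfl | rfl | rfl | ⟨y, hy, rfl⟩ <;>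
  rcases H hc with rfl | rfl | rfl | rfl | rfl | ⟨z, hz, rfl⟩ <;> omega

/-- If the smaller of `a`, `b` exceeded `s`, it would divide the other and `c`, hence `s`. The
larger divides `c`, hence `s` plus the smaller. -/
theorem le_two_mul_of_sum {s a b c : ℕ} (hs : 0 < s) (ha : a = 0 ∨ IsPowTwo a)
    (hb : b = 0 ∨ IsPowTwo b) (hc : IsPowTwo c) (h : s + a + b = c) :
    a ≤ 2 * s ∧ b ≤ 2 * s := by
  wlog hab : a ≤ b generalizing a b
  · exact (this hb ha (by omega) (by omega)).symm
  have h1 : a ≤ s := by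
    rcases ha with rfl | ha
    · omega
    by_contra! hlt
    have hb' : IsPowTwo b := hb.resolve_left (by have := ha.pos; omega)
    have h2 := ha.dvd_of_le hb' hab
    have h3 := ha.dvd_of_le hc (by omega)
    rw [← h, Nat.dvd_add_left h2, Nat.dvd_add_left dvd_rfl] at h3
    exact absurd (Nat.le_of_dvd hs h3) (by omega)
  refine ⟨by omega, ?_⟩
  rcases hb with rfl | hb
  · omega
  by_contra! hlt
  have h3 := hb.dvd_of_le hc (by omega)
  rw [← h, Nat.dvd_add_left dvd_rfl] at h3
  exact absurd (Nat.le_of_dvd (by omega) h3) (by omega)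

theorem le_of_sum {s a c : ℕ} (hs : 0 < s) (ha : a = 0 ∨ IsPowTwo a) (hc : IsPowTwo c)
    (h : s + a = c) : a ≤ s := by
  rcases ha with rfl | ha
  · omega
  by_contra! hlt
  have h3 := ha.dvd_of_le hc (by omega)
  rw [← h, Nat.dvd_add_left dvd_rfl] at h3
  exact absurd (Nat.le_of_dvd hs h3) (by omega)

theorem eq_one_of_succ {a : ℕ} (ha : IsPowTwo a) (h : IsPowTwo (a + 1)) : a = 1 := by
  have h2 := ha.dvd_of_le h (by omega)
  rw [Nat.dvd_add_right dvd_rfl] at h2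
  exact Nat.dvd_one.1 h2

@[simp] theorem pick_nil (p : ℕ × ℕ) : pick [] p = 0 := rfl

theorem pick_eq (l : List ℕ) (u K : ℕ) : pick l (u, K) = if u ∈ l then K else 0 := by
  by_cases h : u ∈ l <;> simp [pick, h]

theorem mul_geomExp (K i u q : ℕ) : K * geomExp i u q = pick (divLengths i q) (u, K) := by
  rw [geomExp, pick_eq]; split_ifs <;> simp

theorem pick_eq_zero_or {l : List ℕ} {u K : ℕ} (hK : IsPowTwo K) :
    pick l (u, K) = 0 ∨ IsPowTwo (pick l (u, K)) := by
  rw [pick_eq]; split_ifs <;> simp [hK]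

/-- The system of equations satisfied by the exponents `K i * u i - 1` of the polynomials
`factor i` in a perfect polynomial, where `K i` is a power of `2` and `u i` is odd. -/
structure ExponentSystem (u K : ℕ → ℕ) : Prop where
  isPowTwo : ∀ i, IsPowTwo (K i)
  mem_oddLengths : ∀ i < 30, u i ∈ oddLengths i
  eqn : ∀ q < 30, K q * u q = (∑ i ∈ Finset.range 30,
    (K i * geomExp i (u i) q + (K i - 1) * succExp i q)) + 1

/-! ### The exponent equations written out -/

namespace ExponentSystem

variable {u K : ℕ → ℕ}

/-- These are M₆, …, M₁₃ and S₉, …, S₁₅, which occur in no 1 + P and in no admissible geometric sum.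
-/
theorem eq_one (h : ExponentSystem u K) {i : ℕ} (hi : i ∈ [7, 8, 9, 10, 11, 12, 13, 14, 23, 24,
    25, 26, 27, 28, 29]) : K i = 1 ∧ u i = 1 := by
  have h0 : ∀ q ∈ [7, 8, 9, 10, 11, 12, 13, 14, 23, 24, 25, 26, 27, 28, 29], q < 30 ∧
      ∀ i < 30, divLengths i q = [] ∧ succExp i q = 0 := by decide +kernel
  have h1 := h.eqn i (h0 i hi).1
  rw [Finset.sum_eq_zero] at h1
  · exact mul_eq_one.1 h1
  · intro j hj
    obtain ⟨h2, h3⟩ := (h0 i hi).2 j (Finset.mem_range.1 hj)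
    simp [mul_geomExp, h2, h3]

theorem length_eq_one (h : ExponentSystem u K) {i : ℕ} (hi : i ∈ [5, 6, 17, 18, 19, 20, 21, 22]) :
    u i = 1 := by
  have h0 : ∀ i ∈ [5, 6, 17, 18, 19, 20, 21, 22], i < 30 ∧ oddLengths i = [1] := by decide
  have h1 := h.mem_oddLengths i (h0 i hi).1
  rw [(h0 i hi).2] at h1
  simpa using h1

theorem eqn_pick (h : ExponentSystem u K) {q : ℕ} (hq : q < 30) : K q * u q =
    (∑ i ∈ Finset.range 30, (pick (divLengths i q) (u i, K i) + (K i - 1) * succExp i q)) + 1 := by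
  simpa only [mul_geomExp] using h.eqn q hq

/-- From q = 3 on, the factors 1 + P contribute nothing, and only x, x + 1, M₁, M₂, M₃, S₁, S₂ have
nontrivial admissible sums. -/
theorem eqn_seven (h : ExponentSystem u K) {q : ℕ} (hq : q < 30) (hq' : 3 ≤ q) : K q * u q =
    pick (divLengths 0 q) (u 0, K 0) + pick (divLengths 1 q) (u 1, K 1) +
    pick (divLengths 2 q) (u 2, K 2) + pick (divLengths 3 q) (u 3, K 3) +
    pick (divLengths 4 q) (u 4, K 4) + pick (divLengths 15 q) (u 15, K 15) +
    pick (divLengths 16 q) (u 16, K 16) + 1 := by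
  have h0 : ∀ q < 30, 3 ≤ q → ∀ i < 30, succExp i q = 0 ∧
      (i ∉ ({0, 1, 2, 3, 4, 15, 16} : Finset ℕ) → divLengths i q = []) := by decide +kernel
  rw [h.eqn_pick hq, ← Finset.sum_subset (s₁ := {0, 1, 2, 3, 4, 15, 16})]
  · simp [h0 q hq hq', add_assoc]
  · decide
  · intro i hi hi'
    obtain ⟨h1, h2⟩ := h0 q hq hq' i (Finset.mem_range.1 hi)
    simp [h1, h2 hi']

theorem eqn_mersenne (h : ExponentSystem u K) :
    pick [7] (u 0, K 0) + pick [7] (u 1, K 1) + pick [7] (u 2, K 2) + 1 = K 3 * u 3 ∧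
    K 4 * u 4 = K 3 * u 3 ∧
    pick [5, 15] (u 0, K 0) + pick [15] (u 1, K 1) + pick [15] (u 2, K 2) + pick [3] (u 4, K 4) +
      pick [3] (u 15, K 15) + 1 = K 5 ∧
    pick [15] (u 0, K 0) + pick [5, 15] (u 1, K 1) + pick [15] (u 2, K 2) + pick [3] (u 3, K 3) +
      pick [3] (u 15, K 15) + 1 = K 6 := by
  have h3 := h.eqn_seven (q := 3) (by norm_num) (by norm_num)
  have h4 := h.eqn_seven (q := 4) (by norm_num) (by norm_num)
  have h5 := h.eqn_seven (q := 5) (by norm_num) (by norm_num)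
  have h6 := h.eqn_seven (q := 6) (by norm_num) (by norm_num)
  rw [h.length_eq_one (by simp)] at h5 h6
  simp only [divLengths, pick_nil] at h3 h4 h5 h6
  omega

theorem eqn_twoMersenne (h : ExponentSystem u K) :
    pick [15] (u 0, K 0) + pick [15] (u 1, K 1) + pick [3, 15] (u 2, K 2) +
      pick [3] (u 16, K 16) + 1 = K 15 * u 15 ∧
    pick [7] (u 2, K 2) + 1 = K 16 * u 16 ∧
    pick [13] (u 0, K 0) + 1 = K 17 ∧ pick [9] (u 0, K 0) + 1 = K 18 ∧
    pick [9] (u 1, K 1) + 1 = K 19 ∧ pick [13] (u 1, K 1) + 1 = K 20 ∧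
    pick [15] (u 2, K 2) + pick [3] (u 16, K 16) + 1 = K 21 ∧
    pick [5, 15] (u 2, K 2) + 1 = K 22 := by
  have h15 := h.eqn_seven (q := 15) (by norm_num) (by norm_num)
  have h16 := h.eqn_seven (q := 16) (by norm_num) (by norm_num)
  have h17 := h.eqn_seven (q := 17) (by norm_num) (by norm_num)
  have h18 := h.eqn_seven (q := 18) (by norm_num) (by norm_num)
  have h19 := h.eqn_seven (q := 19) (by norm_num) (by norm_num)
  have h20 := h.eqn_seven (q := 20) (by norm_num) (by norm_num)
  have h21 := h.eqn_seven (q := 21) (by norm_num) (by norm_num)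
  have h22 := h.eqn_seven (q := 22) (by norm_num) (by norm_num)
  rw [h.length_eq_one (by simp)] at h17 h18 h19 h20 h21 h22
  simp only [divLengths, pick_nil] at h15 h16 h17 h18 h19 h20 h21 h22
  omega

theorem eqn_small (h : ExponentSystem u K) :
    K 1 + K 2 + K 3 + 2 * K 4 + K 5 + 3 * K 6 + K 15 + 2 * K 16 + K 17 + 3 * K 18 + K 19 +
      3 * K 20 + K 21 + 3 * K 22 = K 0 * u 0 + 23 ∧
    K 0 + K 2 + 2 * K 3 + K 4 + 3 * K 5 + K 6 + K 15 + 2 * K 16 + 3 * K 17 + K 18 + 3 * K 19 +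
      K 20 + K 21 + 3 * K 22 = K 1 * u 1 + 23 ∧
    pick [3, 9, 15] (u 0, K 0) + pick [3, 9, 15] (u 1, K 1) + pick [3] (u 3, K 3) +
      pick [3] (u 4, K 4) + K 15 + K 16 + 4 * K 17 + K 18 + K 19 + 4 * K 20 + 3 * K 21 + K 22 =
        K 2 * u 2 + 15 := by
  have h0 := h.eqn_pick (q := 0) (by norm_num)
  have h1 := h.eqn_pick (q := 1) (by norm_num)
  have h2 := h.eqn_pick (q := 2) (by norm_num)
  have hK : ∀ i ∈ [7, 8, 9, 10, 11, 12, 13, 14, 23, 24, 25, 26, 27, 28, 29], K i = 1 :=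
    fun i hi => (h.eq_one hi).1
  simp only [List.forall_mem_cons] at hK
  -- Eliminates the truncated subtractions K - 1; collecting them on the other side gives the
  -- constants 23 and 15.
  obtain ⟨E, hE⟩ : ∃ E : ℕ → ℕ, ∀ i, K i = E i + 1 :=
    ⟨fun i => K i - 1, fun i => (Nat.sub_add_cancel (h.isPowTwo i).pos).symm⟩
  simp only [hE, Nat.add_eq_right] at hK
  simp [Finset.sum_range_succ, divLengths, succExp, succTriple, hE, hK] at h0 h1 h2
  simp only [hE]
  refine ⟨?_, ?_, ?_⟩ <;> linarith

end ExponentSystem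

theorem pick_le {l : List ℕ} {u K n : ℕ} (h : u ∈ l → K ≤ n) : pick l (u, K) ≤ n := by
  rw [pick_eq]; split_ifs with hu
  · exact h hu
  · exact Nat.zero_le n

theorem le_pick {l : List ℕ} {u K : ℕ} (h : u ∈ l) : K ≤ pick l (u, K) := by
  rw [pick_eq, if_pos h]

theorem pick_replace {l : List ℕ} (u K : ℕ) (hl : 1 ∉ l) :
    pick l (u, if u = 1 then 0 else K) = pick l (u, K) := by
  by_cases h : u = 1
  · simp [pick_eq, h, hl]
  · simp [h]

theorem mem_linearPairs {u K : ℕ} (hu : u ∈ oddLengths 0) (hK : IsPowTwo K)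
    (h3 : u = 3 → K < 256) (h5 : u = 5 → K < 64) (h7 : u = 7 → K ≤ 8) (h9 : u = 9 → K = 1)
    (h13 : u = 13 → K = 1) (h15 : u = 15 → K ≤ 8) :
    (u, if u = 1 then 0 else K) ∈ linearPairs := by
  have H : ∀ u ∈ oddLengths 0, ∀ K ∈ powers, (u = 3 → K < 256) → (u = 5 → K < 64) →
      (u = 7 → K ≤ 8) → (u = 9 → K = 1) → (u = 13 → K = 1) → (u = 15 → K ≤ 8) →
      (u, if u = 1 then 0 else K) ∈ linearPairs := by decide +kernel
  by_cases h1 : u = 1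
  · simp [h1, linearPairs]
  · refine H u hu K (hK.mem_powers ?_) h3 h5 h7 h9 h13 h15
    simp only [oddLengths, List.mem_cons, List.not_mem_nil, or_false] at hu
    omega

theorem mem_quadraticPairs {u K : ℕ} (hu : u ∈ oddLengths 2) (hK : IsPowTwo K)
    (h3 : u = 3 → K ≤ 8) (h5 : u = 5 → K = 1) (h7 : u = 7 → K ≤ 2) (h15 : u = 15 → K = 1) :
    (u, if u = 1 then 0 else K) ∈ quadraticPairs := by
  have H : ∀ u ∈ oddLengths 2, ∀ K ∈ powers, (u = 3 → K ≤ 8) → (u = 5 → K = 1) →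
      (u = 7 → K ≤ 2) → (u = 15 → K = 1) →
      (u, if u = 1 then 0 else K) ∈ quadraticPairs := by decide +kernel
  by_cases h1 : u = 1
  · simp [h1, quadraticPairs]
  · refine H u hu K (hK.mem_powers ?_) h3 h5 h7 h15
    simp only [oddLengths, List.mem_cons, List.not_mem_nil, or_false] at hu
    omega

theorem mem_smallPairs {u K : ℕ} (hu : u ∈ [1, 3]) (hK : IsPowTwo K) (h : K * u < 32) :
    (u, K) ∈ smallPairs := by
  have H : ∀ u ∈ [1, 3], ∀ K ∈ powers, K * u < 32 → (u, K) ∈ smallPairs := by decide +kernel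
  refine H u hu K (hK.mem_powers ?_) h
  have : 0 < u := by simp at hu; omega
  nlinarith

/-- Uniqueness of the odd part: a power of 2 is never three times another. It serves to identify the
exponents of M₂ and M₃. -/
theorem eq_and_eq_of_mul_eq {K K' u u' : ℕ} (hK : IsPowTwo K) (hK' : IsPowTwo K')
    (hu : u ∈ [1, 3]) (hu' : u' ∈ [1, 3]) (h : K * u = K' * u') : K = K' ∧ u = u' := by
  have key : ∀ {a b : ℕ}, IsPowTwo a → IsPowTwo b → a ≠ 3 * b := by
    rintro a b ha ⟨k, rfl⟩ hab
    have h2 := IsPowTwo.dvd_of_le ⟨k + 1, rfl⟩ ha (by rw [pow_succ]; omega)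
    rw [hab, pow_succ, mul_comm 3, Nat.mul_dvd_mul_iff_left (Nat.two_pow_pos k)] at h2
    norm_num at h2
  simp only [List.mem_cons, List.not_mem_nil, or_false] at hu hu'
  rcases hu with rfl | rfl <;> rcases hu' with rfl | rfl
  · exact ⟨by omega, rfl⟩
  · exact absurd (by omega) (key hK hK')
  · exact absurd (by omega) (key hK' hK)
  · exact ⟨by omega, rfl⟩

/-! ### Bounds on the powers of two, and solution of the system -/

namespace ExponentSystem

variable {u K : ℕ → ℕ}

theorem eq_of_length_eq_one (h : ExponentSystem u K) (h0 : u 0 = 1) (h1 : u 1 = 1) :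
    K 0 * u 0 = K 1 * u 1 ∧ ∀ i < 30, 2 ≤ i → K i * u i = 1 := by
  obtain ⟨e3, e4, -, -⟩ := h.eqn_mersenne
  obtain ⟨e15, e16, -, -, -, -, -, e22⟩ := h.eqn_twoMersenne
  obtain ⟨e0, e1, -⟩ := h.eqn_small
  have hpos := fun i => (h.isPowTwo i).pos
  rw [h0] at e0
  rw [h1] at e1
  -- Adding `e0` and `e1` cancels K 0 and K 1. The remaining coefficients total 46, which is also
  -- the constant, and every K is at least 1.
  have hsum : K 0 = K 1 ∧ K 2 ≤ 1 ∧ K 3 ≤ 1 ∧ K 4 ≤ 1 ∧ K 5 ≤ 1 ∧ K 6 ≤ 1 ∧ K 15 ≤ 1 ∧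
      K 16 ≤ 1 ∧ K 17 ≤ 1 ∧ K 18 ≤ 1 ∧ K 19 ≤ 1 ∧ K 20 ≤ 1 ∧ K 21 ≤ 1 ∧ K 22 ≤ 1 := by
    have := hpos 2; have := hpos 3; have := hpos 4; have := hpos 5; have := hpos 6
    have := hpos 15; have := hpos 16; have := hpos 17; have := hpos 18; have := hpos 19
    have := hpos 20; have := hpos 21; have := hpos 22
    omega
  obtain ⟨h01, hK⟩ := hsum
  have hone : ∀ i, K i ≤ 1 → K i = 1 := fun i hi => le_antisymm hi (hpos i)
  obtain ⟨k2, k3, k4, k5, k6, k15, k16, k17, k18, k19, k20, k21, k22⟩ := hK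
  have u2 : u 2 = 1 := by
    have m2 := h.mem_oddLengths 2 (by norm_num)
    have m15 := h.mem_oddLengths 15 (by norm_num)
    have m16 := h.mem_oddLengths 16 (by norm_num)
    simp only [oddLengths, List.mem_cons, List.not_mem_nil, or_false] at m2 m15 m16
    rw [hone _ k15] at e15
    rw [hone _ k16] at e15 e16
    rw [hone _ k22] at e22
    rcases m2 with m2 | m2 | m2 | m2 | m2 <;>
      simp [pick_eq, m2, h0, h1, hone _ k2] at e15 e16 e22
    · exact m2
    · rw [← e16] at e15
      simp at e15
      omega
    · omega
  simp [pick_eq, u2, h0, h1] at e3 e16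
  have w16 := (mul_eq_one.1 e16.symm).2
  simp [pick_eq, u2, h0, h1, w16] at e15
  refine ⟨by rw [h0, h1, h01], fun i hi hi2 => ?_⟩
  have w : ∀ j ∈ [5, 6, 17, 18, 19, 20, 21, 22], K j ≤ 1 := by
    simp only [List.forall_mem_cons]
    exact ⟨k5, k6, k17, k18, k19, k20, k21, k22, by simp⟩
  have hi' : i ∈ [7, 8, 9, 10, 11, 12, 13, 14, 23, 24, 25, 26, 27, 28, 29] ∨
      i ∈ [5, 6, 17, 18, 19, 20, 21, 22] ∨ i = 2 ∨ i = 3 ∨ i = 4 ∨ i = 15 ∨ i = 16 := by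
    simp only [List.mem_cons, List.not_mem_nil, or_false]
    omega
  rcases hi' with hi' | hi' | rfl | rfl | rfl | rfl | rfl
  · rw [(h.eq_one hi').1, (h.eq_one hi').2]
  · rw [hone _ (w i hi'), h.length_eq_one hi']
  · rw [u2, hone _ k2]
  · exact e3.symm
  · exact e4.trans e3.symm
  · exact e15.symm
  · exact e16.symm

theorem bounds (h : ExponentSystem u K) :
    (u 2 = 3 → K 2 ≤ 8) ∧ (u 2 = 5 → K 2 = 1) ∧ (u 2 = 7 → K 2 ≤ 2) ∧ (u 2 = 15 → K 2 = 1) ∧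
    (u 0 = 7 → K 0 ≤ 8) ∧ (u 0 = 9 → K 0 = 1) ∧ (u 0 = 13 → K 0 = 1) ∧ (u 0 = 15 → K 0 ≤ 8) ∧
    (u 1 = 7 → K 1 ≤ 8) ∧ (u 1 = 9 → K 1 = 1) ∧ (u 1 = 13 → K 1 = 1) ∧ (u 1 = 15 → K 1 ≤ 8) ∧
    K 3 * u 3 < 32 ∧ K 15 * u 15 < 32 ∧ K 16 * u 16 ≤ 3 := by
  obtain ⟨e3, -, -, -⟩ := h.eqn_mersenne
  obtain ⟨e15, e16, e17, e18, e19, e20, -, e22⟩ := h.eqn_twoMersenne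
  have m3 := h.mem_oddLengths 3 (by norm_num)
  have m15 := h.mem_oddLengths 15 (by norm_num)
  have m16 := h.mem_oddLengths 16 (by norm_num)
  have hp := h.isPowTwo
  have z : ∀ l i, pick l (u i, K i) = 0 ∨ IsPowTwo (pick l (u i, K i)) :=
    fun l i => pick_eq_zero_or (hp i)
  have b1 := le_eight_of_sum (z [7] 0) (z [7] 1) (z [7] 2) (hp 3) m3 e3
  have b2 := le_eight_of_sum (z [7] 1) (z [7] 0) (z [7] 2) (hp 3) m3 (by omega)
  have hm7 : u 2 = 7 → K 2 ≤ 2 := by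
    intro h7
    simp only [oddLengths, List.mem_cons, List.not_mem_nil, or_false] at m16
    simp [pick_eq, h7] at e16
    rcases m16 with m16 | m16 <;> rw [m16] at e16
    · rw [mul_one] at e16
      exact (eq_one_of_succ (hp 2) (e16 ▸ hp 16)).le.trans (by norm_num)
    · rcases (hp 2).cases with k | k | k | k | ⟨a, ha, k⟩ <;>
        rcases (hp 16).cases with k' | k' | k' | k' | ⟨b, hb, k'⟩ <;> omega
  have b3 : pick [7] (u 2, K 2) ≤ 2 := pick_le (by simpa using hm7)
  -- At most one of the two terms is nonzero: if u 2 is 3 or 15, then `e16` gives K 16 * u 16 = 1.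
  -- So the S₁ equation also has three terms, as `le_eight_of_sum` requires.
  have z15 : pick [3, 15] (u 2, K 2) + pick [3] (u 16, K 16) = 0 ∨
      IsPowTwo (pick [3, 15] (u 2, K 2) + pick [3] (u 16, K 16)) := by
    by_cases h2 : u 2 ∈ [3, 15]
    · have h7 : u 2 ∉ [7] := by
        simp only [List.mem_cons, List.not_mem_nil, or_false] at h2 ⊢; omega
      rw [pick_eq [7], if_neg h7, zero_add] at e16
      have := (mul_eq_one.1 e16.symm).2
      rw [pick_eq [3], this]
      simpa using z [3, 15] 2
    · rw [pick_eq [3, 15], if_neg h2, zero_add]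
      exact z [3] 16
  have c1 := le_eight_of_sum (z [15] 0) (z [15] 1) z15 (hp 15) m15 (by omega)
  have c2 := le_eight_of_sum (z [15] 1) (z [15] 0) z15 (hp 15) m15 (by omega)
  have c3 := le_eight_of_sum z15 (z [15] 1) (z [15] 0) (hp 15) m15 (by omega)
  have succ_one : ∀ {l : List ℕ} {i j : ℕ}, pick l (u i, K i) + 1 = K j → u i ∈ l → K i = 1 := by
    intro l i j hj hi
    rw [pick_eq, if_pos hi] at hj
    exact eq_one_of_succ (hp i) (hj ▸ hp j)
  refine ⟨fun hu => ?_, fun hu => succ_one e22 (by simp [hu]), hm7,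
    fun hu => succ_one e22 (by simp [hu]), fun hu => ?_, fun hu => succ_one e18 (by simp [hu]),
    fun hu => succ_one e17 (by simp [hu]), fun hu => ?_, fun hu => ?_,
    fun hu => succ_one e19 (by simp [hu]), fun hu => succ_one e20 (by simp [hu]), fun hu => ?_,
    by omega, by omega, by omega⟩
  · have := le_pick (l := [3, 15]) (u := u 2) (K := K 2) (by simp [hu]); omega
  · exact (le_pick (by simp [hu])).trans b1
  · exact (le_pick (by simp [hu])).trans c1
  · exact (le_pick (by simp [hu])).trans b2
  · exact (le_pick (by simp [hu])).trans c2

theorem pick_bounds (h : ExponentSystem u K) :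
    pick [15] (u 0, K 0) ≤ 8 ∧ pick [15] (u 1, K 1) ≤ 8 ∧ pick [15] (u 2, K 2) ≤ 1 ∧
    pick [9] (u 0, K 0) ≤ 1 ∧ pick [9] (u 1, K 1) ≤ 1 ∧ pick [13] (u 0, K 0) ≤ 1 ∧
    pick [13] (u 1, K 1) ≤ 1 ∧ pick [5, 15] (u 2, K 2) ≤ 1 ∧
    K 3 < 32 ∧ pick [3] (u 3, K 3) ≤ 10 ∧ K 15 < 32 ∧ pick [3] (u 15, K 15) ≤ 10 ∧
    K 16 ≤ 3 ∧ pick [3] (u 16, K 16) ≤ 1 ∧ (u 2 = 1 ∨ K 2 * u 2 ≤ 24 ∧ K 2 ≤ 8) := by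
  obtain ⟨x3, x5, x7, x15, -, a9, a13, a15, -, b9, b13, b15, B3, B15, B16⟩ := h.bounds
  have le_of_mul : ∀ i n, u i ∈ [1, 3] → K i * u i ≤ n → K i ≤ n ∧ 3 * pick [3] (u i, K i) ≤ n := by
    intro i n hi hn
    simp only [List.mem_cons, List.not_mem_nil, or_false] at hi
    rcases hi with hi | hi <;> simp only [pick_eq, hi] at hn ⊢ <;> simp <;> omega
  have g3 := le_of_mul 3 31 (h.mem_oddLengths 3 (by norm_num)) (by omega)
  have g15 := le_of_mul 15 31 (h.mem_oddLengths 15 (by norm_num)) (by omega)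
  have g16 := le_of_mul 16 3 (h.mem_oddLengths 16 (by norm_num)) B16
  refine ⟨pick_le (by simpa using a15), pick_le (by simpa using b15),
    pick_le (by simpa using fun hu => (x15 hu).le), pick_le (by simpa using fun hu => (a9 hu).le),
    pick_le (by simpa using fun hu => (b9 hu).le), pick_le (by simpa using fun hu => (a13 hu).le),
    pick_le (by simpa using fun hu => (b13 hu).le), pick_le ?_, by omega, by omega, by omega,
    by omega, by omega, by omega, ?_⟩
  · simp only [List.mem_cons, List.not_mem_nil, or_false]
    rintro (hu | hu)
    · exact (x5 hu).le
    · exact (x15 hu).le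
  · have m2 := h.mem_oddLengths 2 (by norm_num)
    simp only [oddLengths, List.mem_cons, List.not_mem_nil, or_false] at m2
    rcases m2 with m | m | m | m | m <;> rw [m]
    · exact Or.inl rfl
    · have := x3 m; omega
    · have := x5 m; omega
    · have := x7 m; omega
    · have := x15 m; omega

theorem eq_four (h : ExponentSystem u K) : K 4 = K 3 ∧ u 4 = u 3 :=
  eq_and_eq_of_mul_eq (h.isPowTwo 4) (h.isPowTwo 3) (h.mem_oddLengths 4 (by norm_num))
    (h.mem_oddLengths 3 (by norm_num)) h.eqn_mersenne.2.1

theorem linear_bounds (h : ExponentSystem u K) :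
    pick [5] (u 0, K 0) < 64 ∧ pick [5] (u 1, K 1) < 64 ∧ K 5 < 100 ∧ K 6 < 100 ∧
    pick [3] (u 0, K 0) < 256 ∧ pick [3] (u 1, K 1) < 256 ∧ K 2 < 500 := by
  obtain ⟨q1, q2, q3, q4, q5, q6, q7, q8, q9, q10, q11, q12, q13, q14, q15⟩ := h.pick_bounds
  obtain ⟨-, -, e5, e6⟩ := h.eqn_mersenne
  obtain ⟨-, -, e17, e18, e19, e20, e21, e22⟩ := h.eqn_twoMersenne
  obtain ⟨-, -, e2⟩ := h.eqn_small
  obtain ⟨hK4, hu4⟩ := h.eq_four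
  rw [hK4, hu4] at e5 e2
  have z : ∀ l i, pick l (u i, K i) = 0 ∨ IsPowTwo (pick l (u i, K i)) :=
    fun l i => pick_eq_zero_or (h.isPowTwo i)
  have split3 : ∀ i, pick [3, 9, 15] (u i, K i) =
      pick [3] (u i, K i) + pick [9] (u i, K i) + pick [15] (u i, K i) := by
    intro i
    simp only [pick_eq, List.mem_cons, List.not_mem_nil, or_false]
    split_ifs <;> omega
  have split5 : ∀ i, pick [5, 15] (u i, K i) = pick [5] (u i, K i) + pick [15] (u i, K i) := by
    intro i
    simp only [pick_eq, List.mem_cons, List.not_mem_nil, or_false]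
    split_ifs <;> omega
  rw [split5] at e5 e6
  rw [split3, split3] at e2
  have r5 := le_of_sum (s := pick [15] (u 0, K 0) + pick [15] (u 1, K 1) + pick [15] (u 2, K 2) +
    pick [3] (u 3, K 3) + pick [3] (u 15, K 15) + 1) (by omega) (z [5] 0) (h.isPowTwo 5)
    (by linarith)
  have r6 := le_of_sum (s := pick [15] (u 0, K 0) + pick [15] (u 1, K 1) + pick [15] (u 2, K 2) +
    pick [3] (u 3, K 3) + pick [3] (u 15, K 15) + 1) (by omega) (z [5] 1) (h.isPowTwo 6)
    (by linarith)
  have p15 := (h.isPowTwo 15).pos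
  have p16 := (h.isPowTwo 16).pos
  refine ⟨by omega, by omega, by omega, by omega, ?_⟩
  clear r5 r6 e5 e6
  -- In the M₁ equation only the u = 3 terms of x and x + 1 are still unbounded; `s` collects the
  -- rest. If u 2 = 1 the sum is a power of 2; otherwise it is at most 24.
  obtain ⟨s, hs0, hs, hsum⟩ : ∃ s, 0 < s ∧ s < 100 ∧
      s + pick [3] (u 0, K 0) + pick [3] (u 1, K 1) = K 2 * u 2 :=
    ⟨K 2 * u 2 - pick [3] (u 0, K 0) - pick [3] (u 1, K 1), by omega, by omega, by omega⟩
  rcases q15 with q | q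
  · rw [q, mul_one] at hsum
    have := le_two_mul_of_sum hs0 (z [3] 0) (z [3] 1) (h.isPowTwo 2) hsum
    omega
  · omega

theorem lt_of_length_ne_one (h : ExponentSystem u K) :
    (u 0 ≠ 1 → K 0 < 256) ∧ (u 1 ≠ 1 → K 1 < 256) := by
  obtain ⟨-, -, -, -, a7, a9, a13, a15, b7, b9, b13, b15, -⟩ := h.bounds
  obtain ⟨a5, b5, -, -, a3, b3, -⟩ := h.linear_bounds
  have small : ∀ i n, pick [n] (u i, K i) < 256 → u i = n → K i < 256 := fun i n hi hu =>
    (le_pick (by simp [hu])).trans_lt hi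
  have m0 := h.mem_oddLengths 0 (by norm_num)
  have m1 := h.mem_oddLengths 1 (by norm_num)
  simp only [oddLengths, List.mem_cons, List.not_mem_nil, or_false] at m0 m1
  constructor
  · have := small 0 3 a3
    have := small 0 5 (by omega)
    clear b3 b5 b7 b9 b13 b15 m1
    omega
  · have := small 1 3 b3
    have := small 1 5 (by omega)
    clear a3 a5 a7 a9 a13 a15 m0
    omega

theorem lt_of_ne (h : ExponentSystem u K) (h01 : u 0 ≠ 1 ∨ u 1 ≠ 1) :
    K 0 < 2048 ∧ K 1 < 2048 := by
  obtain ⟨v0, v1⟩ := h.lt_of_length_ne_one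
  obtain ⟨-, -, -, q4, q5, q6, q7, q8, q9, -, q11, -, q13, q14, -⟩ := h.pick_bounds
  obtain ⟨-, -, B5, B6, -, -, B2⟩ := h.linear_bounds
  obtain ⟨-, -, e17, e18, e19, e20, e21, e22⟩ := h.eqn_twoMersenne
  obtain ⟨e0, e1, -⟩ := h.eqn_small
  have q3 := h.pick_bounds.2.2.1
  rw [h.eq_four.1] at e0 e1
  by_cases hu0 : u 0 = 1
  · have hK1 := v1 (by tauto)
    rw [hu0] at e0
    clear v0 v1 e1 h01
    omega
  · have hK0 := v0 hu0
    by_cases hu1 : u 1 = 1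
    · rw [hu1] at e1
      clear v0 v1 e0 h01
      omega
    · have := v1 hu1
      omega

theorem mem_solutions (h : ExponentSystem u K) (h01 : u 0 ≠ 1 ∨ u 1 ≠ 1) :
    [K 0 * u 0, K 1 * u 1, K 2 * u 2, K 3 * u 3, K 5, K 6, K 15 * u 15] ∈ solutions ∧
      K 16 * u 16 = 1 ∧ K 17 = 1 ∧ K 18 = 1 ∧ K 19 = 1 ∧ K 20 = 1 ∧ K 21 = 1 ∧ K 22 = 1 := by
  obtain ⟨x3, x5, x7, x15, a7, a9, a13, a15, b7, b9, b13, b15, B3, B15, B16⟩ := h.bounds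
  obtain ⟨a5, b5, B5, B6, a3, b3, B2⟩ := h.linear_bounds
  obtain ⟨e3, -, e5, e6⟩ := h.eqn_mersenne
  obtain ⟨e15, e16, e17, e18, e19, e20, e21, e22⟩ := h.eqn_twoMersenne
  obtain ⟨e0, e1, e2⟩ := h.eqn_small
  obtain ⟨hK4, hu4⟩ := h.eq_four
  rw [hK4, hu4] at e5 e2
  rw [hK4] at e0 e1
  have hp := h.isPowTwo
  have m0 := h.mem_oddLengths 0 (by norm_num)
  have m1 := h.mem_oddLengths 1 (by norm_num)
  have small : ∀ i n, pick [n] (u i, K i) < 256 → u i = n → K i < 256 := fun i n hi hu =>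
    (le_pick (by simp [hu])).trans_lt hi
  have small5 : ∀ i, pick [5] (u i, K i) < 64 → u i = 5 → K i < 64 := fun i hi hu =>
    (le_pick (by simp [hu])).trans_lt hi
  have L0 := mem_linearPairs m0 (hp 0) (small 0 3 a3) (small5 0 a5) a7 a9 a13 a15
  have L1 := mem_linearPairs m1 (hp 1) (small 1 3 b3) (small5 1 b5) b7 b9 b13 b15
  have L2 := mem_quadraticPairs (h.mem_oddLengths 2 (by norm_num)) (hp 2) x3 x5 x7 x15
  have hlt := h.lt_of_ne h01
  have S := search L0 L1 L2 (mem_smallPairs (h.mem_oddLengths 3 (by norm_num)) (hp 3) B3)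
    (mem_smallPairs (h.mem_oddLengths 15 (by norm_num)) (hp 15) B15)
    (mem_smallPairs (h.mem_oddLengths 16 (by norm_num)) (hp 16)
      (B16.trans_lt (by norm_num)))
    ((hp 0).mem_powers hlt.1) ((hp 1).mem_powers hlt.2) ((hp 2).mem_powers
      (B2.trans (by norm_num))) ((hp 5).mem_powers (B5.trans (by norm_num)))
    ((hp 6).mem_powers (B6.trans (by norm_num)))
    (fun hm => h01.elim (fun h => h (mul_eq_one.1 hm).1) fun h => h (mul_eq_one.1 hm).2)
    (by by_cases hu : u 0 = 1 <;> simp [hu]) (by by_cases hu : u 1 = 1 <;> simp [hu])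
    (by by_cases hu : u 2 = 1 <;> simp [hu])
  simp only [pick_replace _ _ (show 1 ∉ [7] by decide), pick_replace _ _ (show 1 ∉ [15] by decide),
    pick_replace _ _ (show 1 ∉ [3, 15] by decide), pick_replace _ _ (show 1 ∉ [9] by decide),
    pick_replace _ _ (show 1 ∉ [3, 9, 15] by decide),
    pick_replace _ _ (show 1 ∉ [13] by decide), pick_replace _ _ (show 1 ∉ [5, 15] by decide)] at S
  clear a7 a9 a13 a15 b7 b9 b13 b15 x3 x5 x7 x15 B3 B15 B16 a5 b5 a3 b3 B2 B5 B6 L0 L1 L2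
  -- Each of K 17, …, K 22 is a sum of picks plus 1, which lowers the constants 23 and 15 to the 11
  -- and 1 of the search.
  rw [← e17, ← e18, ← e19, ← e20, ← e21, ← e22] at e0 e1 e2 ⊢
  obtain ⟨r, r16, r17, r18, r19, r20, r21, r22⟩ := S e3 e16 e15 (by linarith only [e2]) e5 e6
    (by linarith only [e0]) (by linarith only [e1])
  exact ⟨r, r16, by rw [r17], by rw [r18], by rw [r19], by rw [r20], by rw [r21], by rw [r22]⟩

end ExponentSystem

/-! ### From perfect polynomials to exponents and back -/

theorem irreducible_factor_fin (i : Fin 30) : Irreducible (factor i) := irreducible_factor i.2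

theorem sigma_prod_factor (e : ℕ → ℕ) : sigma (∏ i : Fin 30, factor i ^ e i) =
    ∏ i : Fin 30, ∑ j ∈ Finset.range (e i + 1), factor i ^ j :=
  sigma_prod_pow irreducible_factor_fin factor_injective fun i => e i

theorem exists_exponentSystem {e : ℕ → ℕ} (h : IsPerfect (∏ i : Fin 30, factor i ^ e i)) :
    ∃ u K, ExponentSystem u K ∧ ∀ i, e i + 1 = K i * u i := by
  have hex : ∀ i, ∃ k u, Odd u ∧ e i + 1 = 2 ^ k * u := fun i =>
    Nat.exists_eq_two_pow_mul_odd (Nat.succ_ne_zero _)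
  choose k u hu hk using hex
  have hsig := h.2
  rw [sigma_prod_factor] at hsig
  simp only [hk, geom_sum_two_pow_mul] at hsig
  have hlen : ∀ i < 30, u i ∈ oddLengths i := by
    intro i hi
    -- Perfection enters here: the sum divides σ(A) = A, so it has only allowed prime factors.
    have hd : ∑ j ∈ Finset.range (u i), factor i ^ j ∣ ∏ i : Fin 30, factor i ^ e i := by
      rw [← hsig]
      refine dvd_trans ?_ (Finset.dvd_prod_of_mem _ (Finset.mem_univ (⟨i, hi⟩ : Fin 30)))
      exact (dvd_pow_self _ (by positivity)).mul_right _
    obtain ⟨f, -, hf⟩ := exists_eq_prod_pow_of_dvd irreducible_factor_fin hd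
    exact mem_oddLengths hi (hu i) hf
  refine ⟨u, fun i => 2 ^ k i, ⟨fun i => ⟨k i, rfl⟩, hlen, fun q hq => ?_⟩, hk⟩
  have hfac : ∀ i : Fin 30, (∑ j ∈ Finset.range (u i), factor i ^ j) ^ 2 ^ k i *
      (1 + factor i) ^ (2 ^ k i - 1) = ∏ q : Fin 30, factor q ^
        (2 ^ k i * geomExp i (u i) q + (2 ^ k i - 1) * succExp i q) := by
    intro i
    rw [geom_sum_factor i.2 (hlen i i.2), one_add_factor i.2, Finset.prod_range, Finset.prod_range,
      ← Finset.prod_pow, ← Finset.prod_pow, ← Finset.prod_mul_distrib]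
    refine Finset.prod_congr rfl fun q _ => ?_
    rw [← pow_mul, ← pow_mul, ← pow_add, mul_comm (geomExp _ _ _), mul_comm (succExp _ _)]
  simp only [hfac] at hsig
  rw [Finset.prod_comm] at hsig
  simp only [Finset.prod_pow_eq_pow_sum] at hsig
  have := congrFun (prod_pow_injective irreducible_factor_fin factor_injective hsig) ⟨q, hq⟩
  rw [← hk, Finset.sum_range]
  exact congrArg (· + 1) this.symm

/-- The exponent of `factor i` in the perfect polynomial described by the entry `s` of
`solutions`. -/
def solutionExp (s : List ℕ) : ℕ → ℕ
  | 0 => s.getD 0 1 - 1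
  | 1 => s.getD 1 1 - 1
  | 2 => s.getD 2 1 - 1
  | 3 | 4 => s.getD 3 1 - 1
  | 5 => s.getD 4 1 - 1
  | 6 => s.getD 5 1 - 1
  | 15 => s.getD 6 1 - 1
  | _ => 0

theorem exponents_of_isPerfect {e : ℕ → ℕ} (h : IsPerfect (∏ i : Fin 30, factor i ^ e i)) :
    (e 0 = e 1 ∧ ∀ i < 30, 2 ≤ i → e i = 0) ∨
      ∃ s ∈ solutions, ∀ i < 30, e i = solutionExp s i := by
  obtain ⟨u, K, hS, he⟩ := exists_exponentSystem h
  by_cases h01 : u 0 = 1 ∧ u 1 = 1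
  · obtain ⟨h1, h2⟩ := hS.eq_of_length_eq_one h01.1 h01.2
    refine Or.inl ⟨?_, fun i hi hi2 => ?_⟩
    · have := he 0; have := he 1; omega
    · have := he i; have := h2 i hi hi2; omega
  · obtain ⟨hs, h16, h17, h18, h19, h20, h21, h22⟩ :=
      hS.mem_solutions (by rwa [← not_and_or])
    refine Or.inr ⟨_, hs, ?_⟩
    have e4 := hS.eqn_mersenne.2.1
    have hone : ∀ i ∈ [5, 6, 17, 18, 19, 20, 21, 22], e i + 1 = K i := fun i hi => by
      rw [he, hS.length_eq_one hi, mul_one]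
    have hzero : ∀ i ∈ [7, 8, 9, 10, 11, 12, 13, 14, 23, 24, 25, 26, 27, 28, 29], e i = 0 :=
      fun i hi => by have := he i; rw [(hS.eq_one hi).1, (hS.eq_one hi).2] at this; omega
    simp only [List.forall_mem_cons] at hone hzero
    intro i hi
    have hi' := he i
    interval_cases i <;> simp [solutionExp] <;> omega

theorem isPerfect_of_mem_solutions {s : List ℕ} (hs : s ∈ solutions) :
    IsPerfect (∏ i : Fin 30, factor i ^ solutionExp s i) := by
  have h : ∀ s ∈ solutions, prodBits (fun i => geomBits (code i) (solutionExp s i + 1)) 30 =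
      prodBits (fun i => powBits (code i) (solutionExp s i)) 30 := by decide +kernel
  refine ⟨prod_pow_ne_zero irreducible_factor_fin _, ?_⟩
  rw [sigma_prod_factor, ← Finset.prod_range fun i => factor i ^ solutionExp s i,
    ← Finset.prod_range fun i => ∑ j ∈ Finset.range (solutionExp s i + 1), factor i ^ j]
  simpa only [factor_eq, ofBits_prodBits, ofBits_geomBits, ofBits_powBits] using
    congrArg ofBits (h s hs)

/-- Among x^n (x+1)^n only n = 0 avoids x, and that is constant; all eleven solutions contain x. -/
theorem X_dvd_of_isPerfect {e : ℕ → ℕ} (h : IsPerfect (∏ i : Fin 30, factor i ^ e i))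
    (hdeg : 0 < (∏ i : Fin 30, factor i ^ e i).natDegree) :
    X ∣ ∏ i : Fin 30, factor i ^ e i := by
  have h0 : e 0 ≠ 0 := by
    rcases exponents_of_isPerfect h with ⟨h01, hz⟩ | ⟨s, hs, hse⟩
    · intro h0
      rw [Finset.prod_eq_one, natDegree_one] at hdeg
      · exact hdeg.ne rfl
      · intro i _
        have : e i = 0 := by
          rcases lt_or_ge (i : ℕ) 2 with hi | hi
          · rcases Nat.lt_succ_iff_lt_or_eq.1 hi with hi | hi
            · rw [Nat.lt_one_iff.1 hi, h0]
            · rw [hi, ← h01, h0]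
          · exact hz i i.2 hi
        rw [this, pow_zero]
    · have : ∀ s ∈ solutions, solutionExp s 0 ≠ 0 := by decide
      rw [hse 0 (by norm_num)]
      exact this s hs
  have h1 : factor (0 : Fin 30) = X := (factor_eq 0).trans ofBits_two
  rw [← h1]
  exact (dvd_pow_self _ h0).trans
    (Finset.dvd_prod_of_mem (fun i : Fin 30 => factor i ^ e i) (Finset.mem_univ 0))

theorem IsPerfect.isIndecomposablePerfect {e : ℕ → ℕ}
    (h : IsPerfect (∏ i : Fin 30, factor i ^ e i)) :
    IsIndecomposablePerfect (∏ i : Fin 30, factor i ^ e i) := by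
  refine ⟨h, ?_⟩
  rintro ⟨B, C, hBC, hcop, hB, hC, pB, pC⟩
  have key : ∀ D, D ∣ ∏ i : Fin 30, factor i ^ e i → 0 < D.natDegree → IsPerfect D → X ∣ D := by
    intro D hD hdeg hp
    obtain ⟨f, -, hf⟩ := exists_eq_prod_pow_of_dvd irreducible_factor_fin hD
    obtain ⟨g, hg⟩ : ∃ g : ℕ → ℕ, D = ∏ i : Fin 30, factor i ^ g i := by
      refine ⟨fun n => if hn : n < 30 then f ⟨n, hn⟩ else 0, hf.trans ?_⟩
      exact Finset.prod_congr rfl fun i _ => by simp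
    rw [hg] at hdeg hp ⊢
    exact X_dvd_of_isPerfect hp hdeg
  exact not_isUnit_X (hcop.isUnit_of_dvd' (key B ⟨C, hBC⟩ hB pB)
    (key C ⟨B, by rw [hBC, mul_comm]⟩ hC pC))

/-! ### The polynomials of the statement -/

theorem bar_mul (A B : (ZMod 2)[X]) : bar (A * B) = bar A * bar B := mul_comp A B (X + 1)

theorem bar_pow (A : (ZMod 2)[X]) (n : ℕ) : bar (A ^ n) = bar A ^ n := pow_comp A (X + 1) n

theorem bar_bar (A : (ZMod 2)[X]) : bar (bar A) = A := by
  rw [bar, bar, comp_assoc]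
  have : (X + 1 + 1 : (ZMod 2)[X]) = X := by rw [add_assoc, CharTwo.add_self_eq_zero, add_zero]
  simp [this]

theorem factor_zero : factor 0 = X := (factor_eq 0).trans ofBits_two

theorem factor_one : factor 1 = X + 1 := (factor_eq 1).trans ofBits_three

theorem M_eq_factor (i : Fin 13) : M i = factor (2 + i) := by
  rw [factor_eq]
  fin_cases i <;>
    simp only [M, M₁, M₂, M₃, M₄, M₅, M₆, M₇, M₈, M₉, M₁₀, M₁₁, M₁₂, M₁₃, bar,
      add_comp, pow_comp, X_comp, one_comp] <;>
    simp only [← ofBits_two, ← ofBits_one, ← ofBits_xor, ← ofBits_powBits] <;>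
    exact congrArg ofBits (by decide +kernel)

theorem S_eq_factor (j : Fin 15) : S j = factor (15 + j) := by
  rw [factor_eq]
  fin_cases j <;>
    simp only [S, tripow, M₁] <;>
    simp only [← ofBits_two, ← ofBits_one, ← ofBits_xor, ← ofBits_powBits, ← ofBits_mulBits] <;>
    exact congrArg ofBits (by decide +kernel)

theorem prod_factor_eq (e : ℕ → ℕ) : ∏ i : Fin 30, factor i ^ e i =
    X ^ e 0 * (X + 1) ^ e 1 *
      oddPart (fun i => e (2 + i)) (fun j => e (15 + j)) := by
  rw [← Finset.prod_range fun i => factor i ^ e i, show 30 = 2 + 13 + 15 from rfl,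
    Finset.prod_range_add, Finset.prod_range_add, Finset.prod_range_succ, Finset.prod_range_one,
    factor_zero, factor_one, oddPart]
  simp only [M_eq_factor, S_eq_factor]
  rw [Finset.prod_range, Finset.prod_range, mul_assoc]

theorem exists_exponents (a b : ℕ) (c : Fin 13 → ℕ) (d : Fin 15 → ℕ) :
    ∃ e : ℕ → ℕ, e 0 = a ∧ e 1 = b ∧ (∀ i : Fin 13, e (2 + i) = c i) ∧
      ∀ j : Fin 15, e (15 + j) = d j := by
  refine ⟨fun n => if n = 0 then a else if n = 1 then b else
    if h : n - 2 < 13 then c ⟨n - 2, h⟩ else if h : n - 15 < 15 then d ⟨n - 15, h⟩ else 0,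
    by simp, by simp, fun i => ?_, fun j => ?_⟩
  · have h1 : 2 + (i : ℕ) ≠ 1 := by omega
    simp [h1]
  · have h1 : 15 + (j : ℕ) ≠ 1 := by omega
    have h2 : ¬ 15 + (j : ℕ) - 2 < 13 := by omega
    simp [h1, h2]

/-- The polynomial described by an entry of `solutions`. -/
noncomputable def solutionPoly (s : List ℕ) : (ZMod 2)[X] :=
  ∏ i : Fin 30, factor i ^ solutionExp s i

theorem solutionPoly_eq (x y m b c d t : ℕ) : solutionPoly [x, y, m, b, c, d, t] =
    X ^ (x - 1) * (X + 1) ^ (y - 1) * M₁ ^ (m - 1) * (M₂ * M₃) ^ (b - 1) * M₄ ^ (c - 1) *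
      M₅ ^ (d - 1) * (X ^ 4 + X + 1) ^ (t - 1) := by
  have hS : S 0 = X ^ 4 + X + 1 := by
    rw [S_eq_factor, factor_eq]
    simp only [← ofBits_two, ← ofBits_one, ← ofBits_xor, ← ofBits_powBits]
    exact congrArg ofBits (by decide +kernel)
  rw [solutionPoly, prod_factor_eq, oddPart, ← hS, mul_pow]
  simp [Fin.prod_univ_succ, solutionExp, M]
  ring

theorem bar_X : bar X = X + 1 := by simp [bar]

theorem bar_X_add_one : bar (X + 1) = X := by
  rw [← bar_X, bar_bar]

theorem bar_M₁ : bar M₁ = M₁ := by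
  simp only [bar, M₁, add_comp, pow_comp, X_comp, one_comp]
  simp only [← ofBits_two, ← ofBits_one, ← ofBits_xor, ← ofBits_powBits]
  exact congrArg ofBits (by decide +kernel)

theorem bar_M₂ : bar M₂ = M₃ := by
  simp only [bar, M₂, M₃, add_comp, pow_comp, X_comp, one_comp]
  simp only [← ofBits_two, ← ofBits_one, ← ofBits_xor, ← ofBits_powBits]
  exact congrArg ofBits (by decide +kernel)

theorem bar_M₄ : bar M₄ = M₅ := by
  simp only [bar, M₄, M₅, add_comp, pow_comp, X_comp, one_comp]
  simp only [← ofBits_two, ← ofBits_one, ← ofBits_xor, ← ofBits_powBits]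
  exact congrArg ofBits (by decide +kernel)

theorem bar_quartic : bar (X ^ 4 + X + 1) = X ^ 4 + X + 1 := by
  simp only [bar, add_comp, pow_comp, X_comp, one_comp]
  simp only [← ofBits_two, ← ofBits_one, ← ofBits_xor, ← ofBits_powBits]
  exact congrArg ofBits (by decide +kernel)

theorem bar_M₃ : bar M₃ = M₂ := by rw [← bar_M₂, bar_bar]

theorem bar_M₅ : bar M₅ = M₄ := by rw [← bar_M₄, bar_bar]

theorem mem_knownPerfect_iff {A : (ZMod 2)[X]} :
    A ∈ knownPerfect ↔ ∃ s ∈ solutions, A = solutionPoly s := by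
  simp only [knownPerfect, solutions, Set.mem_insert_iff, Set.mem_singleton_iff, List.mem_cons,
    List.not_mem_nil, or_false, exists_eq_or_imp, exists_eq_left, solutionPoly_eq, T₁, T₃, T₅, T₆,
    T₈, T₁₀, bar_mul, bar_pow, bar_X, bar_X_add_one, bar_M₁, bar_M₂, bar_M₃, bar_M₄, bar_quartic]
  norm_num
  ring_nf

theorem bar_mem_knownPerfect {A : (ZMod 2)[X]} (h : A ∈ knownPerfect) : bar A ∈ knownPerfect := by
  have h5 : bar T₅ = T₅ := by
    simp only [T₅, bar_mul, bar_pow, bar_X, bar_X_add_one, bar_M₄, bar_M₅]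
    ring
  simp only [knownPerfect, Set.mem_insert_iff, Set.mem_singleton_iff] at h
  rcases h with rfl | rfl | rfl | rfl | rfl | rfl | rfl | rfl | rfl | rfl | rfl <;>
    simp [knownPerfect, bar_bar, h5]

theorem isPerfect_iff_mem_knownPerfect {e : ℕ → ℕ}
    (h : oddPart (fun i => e (2 + i)) (fun j => e (15 + j)) ≠ 1) :
    IsPerfect (∏ i : Fin 30, factor i ^ e i) ↔ ∏ i : Fin 30, factor i ^ e i ∈ knownPerfect := by
  constructor
  · intro hp
    rcases exponents_of_isPerfect hp with ⟨-, hz⟩ | ⟨s, hs, hse⟩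
    · refine absurd ?_ h
      rw [oddPart, Finset.prod_eq_one, Finset.prod_eq_one, one_mul]
      · intro j _; rw [hz (15 + j) (by omega) (by omega), pow_zero]
      · intro i _; rw [hz (2 + i) (by omega) (by omega), pow_zero]
    · exact mem_knownPerfect_iff.2 ⟨s, hs, Finset.prod_congr rfl fun i _ => by rw [hse i i.2]⟩
  · intro hk
    obtain ⟨s, hs, hA⟩ := mem_knownPerfect_iff.1 hk
    rw [hA]
    exact isPerfect_of_mem_solutions hs

theorem exists_eq_of_mem_knownPerfect {T : (ZMod 2)[X]} (hT : T ∈ knownPerfect) :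
    ∃ (a b : ℕ) (c : Fin 13 → ℕ) (d : Fin 15 → ℕ),
      1 ≤ a ∧ 1 ≤ b ∧ oddPart c d ≠ 1 ∧ T = X ^ a * (X + 1) ^ b * oddPart c d := by
  obtain ⟨s, hs, rfl⟩ := mem_knownPerfect_iff.1 hT
  have hpos : ∀ s ∈ solutions, 1 ≤ solutionExp s 0 ∧ 1 ≤ solutionExp s 1 ∧
      ∃ i < 30, 2 ≤ i ∧ solutionExp s i ≠ 0 := by decide +kernel
  obtain ⟨h0, h1, i, hi, hi2, hne⟩ := hpos s hs
  refine ⟨_, _, _, _, h0, h1, fun hodd => hne ?_, prod_factor_eq (solutionExp s)⟩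
  have h2 := prod_factor_eq (solutionExp s)
  -- If the odd part were 1, the polynomial would equal its truncation to x and x + 1, and unique
  -- factorization would kill the nonzero exponent at `i`.
  have h3 := prod_factor_eq fun i => if i < 2 then solutionExp s i else 0
  have hone : oddPart (fun i => if 2 + (i : ℕ) < 2 then solutionExp s (2 + i) else 0)
      (fun j => if 15 + (j : ℕ) < 2 then solutionExp s (15 + j) else 0) = 1 := by
    have h2 : ∀ n, ¬ 2 + n < 2 := fun n => by omega
    have h15 : ∀ n, ¬ 15 + n < 2 := fun n => by omega
    simp only [oddPart, h2, h15, if_false, pow_zero, Finset.prod_const_one, mul_one]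
  rw [hone] at h3
  rw [hodd] at h2
  have h4 := congrFun (prod_pow_injective irreducible_factor_fin factor_injective
    (h2.trans h3.symm)) ⟨i, hi⟩
  simpa [show ¬ i < 2 by omega] using h4

end BinaryPerfect

theorem theorem1p1 :
    (∀ (a b : ℕ) (c : Fin 13 → ℕ) (d : Fin 15 → ℕ) (A : (ZMod 2)[X]),
      1 ≤ a → 1 ≤ b → oddPart c d ≠ 1 → A = X ^ a * (X + 1) ^ b * oddPart c d →
        List.TFAE
          [IsPerfect A,
           IsIndecomposablePerfect A,
           A ∈ knownPerfect ∧ bar A ∈ knownPerfect,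
           A ∈ knownPerfect ∨ bar A ∈ knownPerfect]) ∧
    (∀ T ∈ knownPerfect, ∃ (a b : ℕ) (c : Fin 13 → ℕ) (d : Fin 15 → ℕ),
      1 ≤ a ∧ 1 ≤ b ∧ oddPart c d ≠ 1 ∧ T = X ^ a * (X + 1) ^ b * oddPart c d) := by
  refine ⟨fun a b c d A _ _ hodd hA => ?_, fun T hT => exists_eq_of_mem_knownPerfect hT⟩
  obtain ⟨e, rfl, rfl, hc, hd⟩ := exists_exponents a b c d
  obtain rfl := funext hc
  obtain rfl := funext hd
  rw [← prod_factor_eq e] at hA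
  have hiff := isPerfect_iff_mem_knownPerfect hodd
  rw [← hA] at hiff
  tfae_have 1 → 2 := by
    intro h
    rw [hA] at h ⊢
    exact h.isIndecomposablePerfect
  tfae_have 2 → 3 := fun h => ⟨hiff.1 h.1, bar_mem_knownPerfect (hiff.1 h.1)⟩
  tfae_have 3 → 4 := fun h => Or.inl h.1
  tfae_have 4 → 1 := by
    rintro (h | h)
    · exact hiff.2 h
    · exact hiff.2 (bar_bar A ▸ bar_mem_knownPerfect h)
  tfae_finish
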